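/- **Setting.** Let $N,K,T\ge 1$ be integers. There are $N$ experts $V=[N]$ and $K$ actions; $\Delta_d$ denotes the probability simplex in $\mathbb{R}^d$, $x\lor y=\max\{x,y\}$, $x\land y=\min\{x,y\}$, $x_+=x\lor 0$, and $\log_2(x)_+=(\log_2 x)_+$ (equal to $0$ at $x=0$). Fix loss vectors $\ell_1,\dots,\ell_T\in[0,1]^K$ and recommendations $\theta_t^i\in\Delta_K$ ($i\in V$, $t\in[T]$), and let $y_t(i)=\sum_a\theta_t^i(a)\ell_t(a)$. For $\tau\in\Delta_N$ let $$Q_t(\tau)=\sum_{i\in V}\tau(i)\,\chi^2\Big(\theta_t^i\,\Big\|\,\sum_{j\in V}\tau(j)\theta_t^j\Big),\qquad \chi^2(p\,\|\,q)=\sum_{a}q(a)\Big(\frac{p(a)}{q(a)}-1\Big)^2,$$ where in $Q_t(\tau)$ actions $a$ with $\sum_j\tau(j)\theta_t^j(a)=0$ and experts $i$ with $\tau(i)=0$ contribute $0$. Let $\mathcal{C}_t=\sup_{\tau\in\Delta_N}Q_t(\tau)$ be the chi-squared capacity at round $t$ and $\overline{\mathcal{C}}_T=\frac1T\sum_{t=1}^T\mathcal{C}_t$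 its average. **Algorithm** (input $J\in(0,N]$; $N$ and $T$ are known). For integers $r$ let $$q_r=\frac12\Big(1+\frac{\ln(N/2^r)}{\sqrt{\ln(N/2^r)^2+4}+2}\Big),\qquad \eta_r=\min\Big\{\sqrt{\frac{q_r(N^{1-q_r}-1)}{eT(1-q_r)(2^r)^{q_r}}},\ \frac{q_r}{1-q_r}\Big(1-e^{\frac{q_r-1}{2-q_r}}\Big)\Big\},$$ and for $q\in(0,1)$ let $\psi_q(x)=\frac{1}{1-q}\big(1-\sum_{i\in V}x(i)^q\big)$ on $\Delta_N$. Start with $r_1=\lceil\log_2J\rceil-1$, $m_1=1$ and $p_1$ uniform on $V$. In each round $t=1,\dots,T$: the advice $(\theta_t^i)_{i\in V}$ is revealed; the learner draws $I_t\sim p_t$ and then $A_t\sim\theta_t^{I_t}$ (given the past), observes $\ell_t(A_t)$, and sets $\hat y_t(i)=\frac{\theta_t^i(A_t)}{\sum_jp_t(j)\theta_t^j(A_t)}\ell_t(A_t)$ for $i\in V$. * If $\frac1T\sum_{s=m_t}^tQ_s(p_s)>2^{r_t+1}$, then $p_{t+1}$ is uniform on $V$, $r_{t+1}=\big\lceil\log_2\big(\frac1T\sum_{s=m_t}^tQ_s(p_s)\big)\big\rceil-1$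 and $m_{t+1}=t+1$. * Otherwise $p_{t+1}=\operatorname{argmin}_{p\in\Delta_N}\ \eta_{r_t}\big\langle\sum_{s=m_t}^t\hat y_s,\,p\big\rangle+\psi_{q_{r_t}}(p)$, $r_{t+1}=r_t$ and $m_{t+1}=m_t$. Its expected regret is $R_T=\mathbb{E}\big[\sum_{t=1}^T\ell_t(A_t)\big]-\min_{i\in V}\sum_{t=1}^Ty_t(i)$, the expectation being over the draws of the learner. **Theorem.** Assume $T\ge\ln(e^2N)$. For every $J\in(0,N]$, the algorithm with input $J$ satisfies $$R_T\le 38e\sqrt{(\overline{\mathcal{C}}_T\lor J)\,T\,\ln\Big(\frac{e^2N}{\overline{\mathcal{C}}_T\lor J\lor1}\Big)}+\log_2\Big(\frac{\overline{\mathcal{C}}_T}{J}\Big)_+ +\frac{18e}{5}\log_2\Big(\frac{4\big((JT\lor\overline{\mathcal{C}}_TT)\land\ln(e^2N)\big)}{JT}\Big)_+\ln(e^2N)+1.$$ In particular, with input $J=\ln(e^2N)/T$ it satisfies $$R_T\le 38e\sqrt{\overline{\mathcal{C}}_T\,T\,\ln\Big(\frac{e^2N}{\overline{\mathcal{C}}_T\lor1}\Big)}+\log_2\Big(\frac{\overline{\mathcal{C}}_TT}{\ln(e^2N)}\Big)_+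 +46e\ln(e^2N)+1.$$ -/

import Mathlib

noncomputable section

namespace ExpertAdvice

/-- The distribution on `Fin n` with weights `u`. -/
def toPMF {n : ℕ} (u : stdSimplex ℝ (Fin n)) : PMF (Fin n) :=
  PMF.ofFintype (fun i => ENNReal.ofReal (u.1 i)) (by
    rw [← ENNReal.ofReal_sum_of_nonneg (fun i _ => u.2.1 i), u.2.2, ENNReal.ofReal_one])

/-- The uniform distribution in the simplex. -/
def uniform (N : ℕ) [NeZero N] : stdSimplex ℝ (Fin N) :=
  ⟨fun _ => 1 / (N : ℝ), fun _ => by positivity, by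
    simp [Finset.card_univ, mul_inv_cancel₀ (Nat.cast_ne_zero.mpr (NeZero.ne N) : (N : ℝ) ≠ 0)]⟩

instance (N : ℕ) [NeZero N] : Nonempty (stdSimplex ℝ (Fin N)) := ⟨uniform N⟩

/-- The advice of one round: expert `i` recommends the distribution `θ i` over the actions. -/
abbrev Advice (N K : ℕ) := Fin N → stdSimplex ℝ (Fin K)

/-- The mixture `∑ j, τ j • θ j` of the recommendations. -/
def mix {N K : ℕ} (θ : Advice N K) (τ : stdSimplex ℝ (Fin N)) (a : Fin K) : ℝ :=
  ∑ j, τ.1 j * (θ j).1 a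

/-- Chi-squared divergence `χ²(p ‖ q)`, with the summand read as `0` where `q a = 0`. (In `Q` below,
an expert with positive weight puts no mass on an action `a` with `mix θ τ a = 0`, so that this
convention only touches experts of weight `0`.) -/
def chiSq {K : ℕ} (p q : Fin K → ℝ) : ℝ :=
  ∑ a, q a * (p a / q a - 1) ^ 2

/-- `Q(τ) = ∑ i, τ i * χ²(θ i ‖ ∑ j, τ j • θ j)`. -/
def Q {N K : ℕ} (θ : Advice N K) (τ : stdSimplex ℝ (Fin N)) : ℝ :=
  ∑ i, τ.1 i * chiSq (θ i).1 (mix θ τ)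

/-- Chi-squared capacity of the recommendations of one round. -/
def capacity {N K : ℕ} (θ : Advice N K) : ℝ :=
  ⨆ τ : stdSimplex ℝ (Fin N), Q θ τ

/-- Average capacity over the rounds `0, …, T - 1`. -/
def avgCapacity {N K : ℕ} (T : ℕ) (θ : ℕ → Advice N K) : ℝ :=
  (1 / (T : ℝ)) * ∑ t ∈ Finset.range T, capacity (θ t)

/-- Negative `q`-Tsallis entropy. -/
def tsallis {N : ℕ} (q : ℝ) (x : Fin N → ℝ) : ℝ :=
  1 / (1 - q) * (1 - ∑ i, x i ^ q)

/-- The objective `η ⟨Y, p⟩ + ψ_q(p)`. -/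
def ftrlObjective {N : ℕ} (q η : ℝ) (Y : Fin N → ℝ) (p : stdSimplex ℝ (Fin N)) : ℝ :=
  η * ∑ i, Y i * p.1 i + tsallis q p.1

/-- For `q > 0` the objective attains its minimum on the simplex. -/
theorem exists_ftrl_min {N : ℕ} [NeZero N] {q : ℝ} (hq : 0 < q) (η : ℝ) (Y : Fin N → ℝ) :
    ∃ p : stdSimplex ℝ (Fin N), ∀ p', ftrlObjective q η Y p ≤ ftrlObjective q η Y p' := by
  have hc : Continuous (ftrlObjective q η Y) := by
    unfold ftrlObjective tsallis
    have h : ∀ i, Continuous fun p : stdSimplex ℝ (Fin N) => p.1 i := fun i =>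
      (continuous_apply i).comp continuous_subtype_val
    refine (continuous_const.mul (continuous_finsetSum _ fun i _ =>
      continuous_const.mul (h i))).add (continuous_const.mul (continuous_const.sub
        (continuous_finsetSum _ fun i _ => (h i).rpow_const fun _ => Or.inr hq.le)))
  have : CompactSpace (stdSimplex ℝ (Fin N)) :=
    isCompact_iff_compactSpace.mp (isCompact_stdSimplex ℝ (Fin N))
  obtain ⟨p, -, hp⟩ := isCompact_univ.exists_isMinOn Set.univ_nonempty hc.continuousOn
  exact ⟨p, fun p' => hp (Set.mem_univ p')⟩

/-- The minimizer of `η ⟨Y, p⟩ + ψ_q(p)` over the simplex. -/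
def ftrl {N : ℕ} [NeZero N] (q η : ℝ) (Y : Fin N → ℝ) : stdSimplex ℝ (Fin N) :=
  Classical.epsilon fun p => ∀ p', ftrlObjective q η Y p ≤ ftrlObjective q η Y p'

/-- The entropy parameter `q_r`. -/
def qParam (N : ℕ) (r : ℤ) : ℝ :=
  1 / 2 * (1 + Real.log ((N : ℝ) / 2 ^ r) /
    (Real.sqrt (Real.log ((N : ℝ) / 2 ^ r) ^ 2 + 4) + 2))

/-- The learning rate `η_r`. -/
def etaParam (N T : ℕ) (r : ℤ) : ℝ :=
  min
    (Real.sqrt (qParam N r * ((N : ℝ) ^ (1 - qParam N r) - 1) /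
      (Real.exp 1 * T * (1 - qParam N r) * ((2 : ℝ) ^ r) ^ qParam N r)))
    (qParam N r / (1 - qParam N r) * (1 - Real.exp ((qParam N r - 1) / (2 - qParam N r))))

/-- The learner's state at the beginning of round `t`: the current exponent `r_t`, the distribution
`p_t`, and the two sums over the rounds `s = m_t, …, t - 1` since the last restart `m_t`. -/
structure State (N : ℕ) where
  /-- the exponent `r_t` -/
  r : ℤ
  /-- the distribution `p_t` over the experts -/
  p : stdSimplex ℝ (Fin N)
  /-- the sum of the loss estimates since the last restart -/
  cumLoss : Fin N → ℝ
  /-- the sum of the `Q_s(p_s)` since the last restart -/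
  cumQ : ℝ

/-- The initial state, for the input `J`. -/
def initState (N : ℕ) [NeZero N] (J : ℝ) : State N where
  r := ⌈Real.logb 2 J⌉ - 1
  p := uniform N
  cumLoss := 0
  cumQ := 0

/-- Importance-weighted loss estimate of expert `i`, when action `a` was played according to the
distribution `p` over the experts and the loss `x` was observed. -/
def lossEstimate {N K : ℕ} (θ : Advice N K) (p : stdSimplex ℝ (Fin N)) (a : Fin K) (x : ℝ)
    (i : Fin N) : ℝ :=
  (θ i).1 a / mix θ p a * x

open Classical in
/-- Update at the end of a round with advice `θ`, played action `a` and observed loss `x`. -/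
def step {N K : ℕ} [NeZero N] (T : ℕ) (S : State N) (θ : Advice N K) (a : Fin K) (x : ℝ) :
    State N :=
  let cumQ' : ℝ := S.cumQ + Q θ S.p
  let cumLoss' : Fin N → ℝ := fun i => S.cumLoss i + lossEstimate θ S.p a x i
  if 1 / (T : ℝ) * cumQ' > 2 ^ (S.r + 1) then
    { r := ⌈Real.logb 2 (1 / (T : ℝ) * cumQ')⌉ - 1
      p := uniform N
      cumLoss := 0
      cumQ := 0 }
  else
    { r := S.r
      p := ftrl (qParam N S.r) (etaParam N T S.r) cumLoss'
      cumLoss := cumLoss'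
      cumQ := cumQ' }

/-- A history of `t` rounds: the drawn expert and the played action of each round. -/
abbrev History (N K t : ℕ) := Fin t → Fin N × Fin K

/-- The learner's state after the history `h` of the first `t` rounds (rounds are numbered from `0`);
it uses the losses of the played actions only. -/
def state {N K : ℕ} [NeZero N] (T : ℕ) (J : ℝ) (θ : ℕ → Advice N K) (ℓ : ℕ → Fin K → ℝ) :
    (t : ℕ) → History N K t → State N
  | 0, _ => initState N J
  | t + 1, h =>
      let a := (h (Fin.last t)).2
      step T (state T J θ ℓ t fun s => h s.castSucc) (θ t) a (ℓ t a)

/-- The law of the history of the first `t` rounds: in each round an expert `i` is drawn from the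
current distribution `p` and then an action `a` from the recommendation of `i`. -/
def historyLaw {N K : ℕ} [NeZero N] (T : ℕ) (J : ℝ) (θ : ℕ → Advice N K) (ℓ : ℕ → Fin K → ℝ) :
    (t : ℕ) → PMF (History N K t)
  | 0 => PMF.pure Fin.elim0
  | t + 1 =>
      (historyLaw T J θ ℓ t).bind fun h =>
        (toPMF (state T J θ ℓ t h).p).bind fun i =>
          (toPMF (θ t i)).bind fun a =>
            PMF.pure (Fin.snoc (α := fun _ => Fin N × Fin K) h (i, a))

/-- Loss `∑ a, θ i a * ℓ a` of expert `i` in one round. -/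
def expertLoss {N K : ℕ} (θ : Advice N K) (ℓ : Fin K → ℝ) (i : Fin N) : ℝ :=
  ∑ a, (θ i).1 a * ℓ a

/-- Expected regret over `T` rounds of the algorithm with input `J`, against the best expert. -/
def regret {N K : ℕ} [NeZero N] (T : ℕ) (J : ℝ) (θ : ℕ → Advice N K) (ℓ : ℕ → Fin K → ℝ) : ℝ :=
  (∑ h : History N K T, (historyLaw T J θ ℓ T h).toReal * ∑ t : Fin T, ℓ t (h t).2) -
    ⨅ i : Fin N, ∑ t ∈ Finset.range T, expertLoss (θ t) (ℓ t) i

/-- `log₂(x)₊`, the positive part of the binary logarithm. -/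
def logTwoPos (x : ℝ) : ℝ := max (Real.logb 2 x) 0

end ExpertAdvice

end

noncomputable section

namespace ExpertAdvice

/-! ### Expectation over histories and the potential method. -/

section

/-! Between restarts the algorithm is follow-the-regularized-leader with a fixed Tsallis entropy.
Centring the loss estimates by the observed loss does not move the minimizer and turns the
second-order term of the analysis into `∑ p_i^(2-q) χ²(θ_i ‖ mix)` (`ftrl_stability`, `ftrl_round`).
Since `p_i χ²(θ_i ‖ mix) ≤ 1`, this is at most the tangent of `Q ↦ Q^q` at any chosen point
(`sum_rpow_mul_chiSq_le`). The tangent at `X = 2^(r+1)` is affine in `Q`, so its sum over an epoch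
depends only on the number of rounds and on the accumulated `Q`, and the restart rule keeps the
latter below `T X`.

All this is packed into one potential: the regret still owed by the current regularized leader, the
unspent variance budget, and the cost of every exponent not yet reached. It decreases in expectation
by at least the regret of each round. At a restart the exponent strictly increases, so the new epoch
is paid for by its own term, and the round itself by the extra `1` there. Exponents stay below `log₂
(max C̄ J)` because accumulated `Q` is dominated by accumulated capacity
(`regret_le_sum_epochCost`).

It remains to add up epoch costs. The choice of `q_r` makes entropy range times `(2^r)^q` of order
`2^r ln (e² N / (2^r ∨ 1))`, so an epoch costs the square root of `T` times this, except that the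
cap on the learning rate adds a `ln (e² N)` term when `2^r T < ln (e² N)` (`epochCost_le`). The
square roots sum geometrically, and the exceptional exponents are counted by `card_exponents_le`. -/

theorem sum_bind_toReal_mul {α β : Type*} [Fintype α] [Fintype β] (μ : PMF α) (f : α → PMF β)
    (g : β → ℝ) :
    ∑ y, ((μ.bind f) y).toReal * g y = ∑ x, (μ x).toReal * ∑ y, (f x y).toReal * g y := by
  simp_rw [PMF.bind_apply, tsum_fintype, Finset.mul_sum]
  rw [Finset.sum_comm]
  refine Finset.sum_congr rfl fun y _ => ?_
  rw [ENNReal.toReal_sum fun x _ => ENNReal.mul_ne_top (μ.apply_ne_top x) ((f x).apply_ne_top y),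
    Finset.sum_mul]
  simp only [ENNReal.toReal_mul, mul_assoc]

theorem sum_pure_toReal_mul {α : Type*} [Fintype α] (x : α) (g : α → ℝ) :
    ∑ y, (PMF.pure x y).toReal * g y = g x := by
  classical
  rw [Finset.sum_eq_single x] <;> simp +contextual [PMF.pure_apply]

theorem toPMF_toReal {n : ℕ} (u : stdSimplex ℝ (Fin n)) (i : Fin n) :
    (toPMF u i).toReal = u.1 i := by
  simp only [toPMF, PMF.ofFintype_apply]
  exact ENNReal.toReal_ofReal (u.2.1 i)

variable {N K : ℕ} [NeZero N]

/-- The expectation of a function of the history, after conditioning on all rounds but the last. -/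
theorem sum_historyLaw_succ (T : ℕ) (J : ℝ) (θ : ℕ → Advice N K) (ℓ : ℕ → Fin K → ℝ) (t : ℕ)
    (g : History N K (t + 1) → ℝ) :
    ∑ h, (historyLaw T J θ ℓ (t + 1) h).toReal * g h =
      ∑ h, (historyLaw T J θ ℓ t h).toReal * ∑ i, (state T J θ ℓ t h).p.1 i *
        ∑ a, (θ t i).1 a * g (Fin.snoc (α := fun _ => Fin N × Fin K) h (i, a)) := by
  rw [historyLaw, sum_bind_toReal_mul]
  simp only [sum_bind_toReal_mul, sum_pure_toReal_mul, toPMF_toReal]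

theorem state_snoc (T : ℕ) (J : ℝ) (θ : ℕ → Advice N K) (ℓ : ℕ → Fin K → ℝ) (t : ℕ)
    (h : History N K t) (i : Fin N) (a : Fin K) :
    state T J θ ℓ (t + 1) (Fin.snoc (α := fun _ => Fin N × Fin K) h (i, a)) =
      step T (state T J θ ℓ t h) (θ t) a (ℓ t a) := by
  simp [state]

theorem sum_mul_sum_eq_sum_mix {N K : ℕ} (θ : Advice N K) (p : stdSimplex ℝ (Fin N))
    (g : Fin K → ℝ) :
    ∑ i, p.1 i * ∑ a, (θ i).1 a * g a = ∑ a, mix θ p a * g a := by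
  simp_rw [mix, Finset.mul_sum, Finset.sum_mul]
  rw [Finset.sum_comm]
  simp only [mul_assoc]

theorem mix_nonneg {N K : ℕ} (θ : Advice N K) (p : stdSimplex ℝ (Fin N)) (a : Fin K) :
    0 ≤ mix θ p a :=
  Finset.sum_nonneg fun j _ => mul_nonneg (p.2.1 j) ((θ j).2.1 a)

theorem sum_mix {N K : ℕ} (θ : Advice N K) (p : stdSimplex ℝ (Fin N)) :
    ∑ a, mix θ p a = 1 := by
  have := sum_mul_sum_eq_sum_mix θ p fun _ => 1
  simp only [mul_one] at this
  rw [← this]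
  simp only [(θ _).2.2, mul_one, p.2.2]

/-- If a potential of the state decreases in expectation by at least the regret of each round
against expert `i`, then its initial value bounds the regret against `i`. -/
theorem sum_loss_le_of_potential (T : ℕ) (J : ℝ) (θ : ℕ → Advice N K) (ℓ : ℕ → Fin K → ℝ)
    (i : Fin N) (Inv : ℕ → State N → Prop) (U : ℕ → State N → ℝ)
    (h_init : Inv 0 (initState N J))
    (h_step : ∀ t < T, ∀ S, Inv t S → ∀ a, Inv (t + 1) (step T S (θ t) a (ℓ t a)))
    (h_pot : ∀ t < T, ∀ S, Inv t S →
      ∑ a, mix (θ t) S.p a * (ℓ t a + U (t + 1) (step T S (θ t) a (ℓ t a))) ≤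
        expertLoss (θ t) (ℓ t) i + U t S)
    (h_end : ∀ S, Inv T S → 0 ≤ U T S) :
    ∑ h : History N K T, (historyLaw T J θ ℓ T h).toReal * ∑ t : Fin T, ℓ t (h t).2 ≤
      (∑ t ∈ Finset.range T, expertLoss (θ t) (ℓ t) i) + U 0 (initState N J) := by
  have inv : ∀ t ≤ T, ∀ h, Inv t (state T J θ ℓ t h) := by
    intro t
    induction t with
    | zero => intro _ h; exact h_init
    | succ t ih =>
      intro ht h
      exact h_step t ht _ (ih (by omega) _) _
  have main : ∀ t ≤ T, ∑ h : History N K t, (historyLaw T J θ ℓ t h).toReal *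
      ((∑ s : Fin t, ℓ s (h s).2) + U t (state T J θ ℓ t h)) ≤
      (∑ t ∈ Finset.range t, expertLoss (θ t) (ℓ t) i) + U 0 (initState N J) := by
    intro t
    induction t with
    | zero =>
      intro _
      rw [historyLaw, sum_pure_toReal_mul]
      simp [state]
    | succ t ih =>
      intro ht
      rw [sum_historyLaw_succ, Finset.sum_range_succ]
      simp only [state_snoc, Fin.sum_univ_castSucc, Fin.snoc_castSucc, Fin.snoc_last,
        Fin.val_castSucc, Fin.val_last, sum_mul_sum_eq_sum_mix]
      have h1 : ∀ h : History N K t, ∑ a, mix (θ t) (state T J θ ℓ t h).p a *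
          ((∑ s : Fin t, ℓ s (h s).2) + ℓ t a +
            U (t + 1) (step T (state T J θ ℓ t h) (θ t) a (ℓ t a))) ≤
          (∑ s : Fin t, ℓ s (h s).2) + U t (state T J θ ℓ t h) + expertLoss (θ t) (ℓ t) i := by
        intro h
        have h2 := h_pot t ht _ (inv t (by omega) h)
        simp only [add_assoc, mul_add, Finset.sum_add_distrib, ← Finset.sum_mul, sum_mix,
          one_mul] at h2 ⊢
        linarith
      have h3 : ∑ h : History N K t, (historyLaw T J θ ℓ t h).toReal = 1 := by
        rw [← ENNReal.toReal_sum fun h _ => PMF.apply_ne_top _ h,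
          ← tsum_fintype (L := .unconditional _), PMF.tsum_coe, ENNReal.toReal_one]
      calc _ ≤ ∑ h : History N K t, (historyLaw T J θ ℓ t h).toReal *
            ((∑ s : Fin t, ℓ s (h s).2) + U t (state T J θ ℓ t h) +
              expertLoss (θ t) (ℓ t) i) :=
            Finset.sum_le_sum fun h _ => mul_le_mul_of_nonneg_left (h1 h) ENNReal.toReal_nonneg
        _ = (∑ h : History N K t, (historyLaw T J θ ℓ t h).toReal *
            ((∑ s : Fin t, ℓ s (h s).2) + U t (state T J θ ℓ t h))) +
              expertLoss (θ t) (ℓ t) i := by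
            simp_rw [mul_add _ _ (expertLoss _ _ _)]
            rw [Finset.sum_add_distrib, ← Finset.sum_mul, h3, one_mul]
        _ ≤ _ := by have := ih (by omega); linarith
  refine le_trans (Finset.sum_le_sum fun h _ => ?_) (main T le_rfl)
  exact mul_le_mul_of_nonneg_left (le_add_of_nonneg_right (h_end _ (inv T le_rfl h)))
    ENNReal.toReal_nonneg

/-- A bound on the regret against every expert is a bound on the regret. -/
theorem regret_le_of_forall {T : ℕ} {J : ℝ} {θ : ℕ → Advice N K} {ℓ : ℕ → Fin K → ℝ} {B : ℝ}
    (h : ∀ i, ∑ h : History N K T, (historyLaw T J θ ℓ T h).toReal * ∑ t : Fin T, ℓ t (h t).2 ≤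
      (∑ t ∈ Finset.range T, expertLoss (θ t) (ℓ t) i) + B) :
    regret T J θ ℓ ≤ B := by
  obtain ⟨i, hi⟩ := exists_eq_ciInf_of_finite
    (f := fun i : Fin N => ∑ t ∈ Finset.range T, expertLoss (θ t) (ℓ t) i)
  rw [regret, ← hi]
  have := h i
  linarith

end

/-! ### Chi-squared divergences of the advice and the capacity. -/

section
variable {N K : ℕ}

theorem chiSq_nonneg {p q : Fin K → ℝ} (hq : ∀ a, 0 ≤ q a) : 0 ≤ chiSq p q :=
  Finset.sum_nonneg fun a _ => mul_nonneg (hq a) (sq_nonneg _)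

theorem weight_mul_le_mix (θ : Advice N K) (τ : stdSimplex ℝ (Fin N)) (i : Fin N) (a : Fin K) :
    τ.1 i * (θ i).1 a ≤ mix θ τ a :=
  Finset.single_le_sum (f := fun j => τ.1 j * (θ j).1 a)
    (fun j _ => mul_nonneg (τ.2.1 j) ((θ j).2.1 a)) (Finset.mem_univ i)

/-- The mixture dominates `τ_i θ_i` pointwise, hence `τ_i θ_i² / mix ≤ θ_i`; expanding the square
and summing over actions gives `1 - 2 τ_i + τ_i`. -/
theorem weight_mul_chiSq_le (θ : Advice N K) (τ : stdSimplex ℝ (Fin N)) (i : Fin N) :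
    τ.1 i * chiSq (θ i).1 (mix θ τ) ≤ 1 - τ.1 i := by
  have h : ∀ a, τ.1 i * (mix θ τ a * ((θ i).1 a / mix θ τ a - 1) ^ 2) ≤
      (θ i).1 a - 2 * τ.1 i * (θ i).1 a + τ.1 i * mix θ τ a := by
    intro a
    have h1 := weight_mul_le_mix θ τ i a
    have h2 := (θ i).2.1 a
    have h3 := τ.2.1 i
    rcases (mix_nonneg θ τ a).eq_or_lt with h0 | h0
    · rw [← h0] at h1 ⊢
      have : τ.1 i * (θ i).1 a = 0 := le_antisymm h1 (mul_nonneg h3 h2)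
      simp only [zero_mul, mul_zero]
      nlinarith
    · have h4 : τ.1 i * (θ i).1 a * ((θ i).1 a / mix θ τ a) ≤ (θ i).1 a := by
        rw [mul_div_assoc', div_le_iff₀ h0, mul_comm ((θ i).1 a)]
        exact mul_le_mul_of_nonneg_right h1 h2
      have h5 : mix θ τ a * ((θ i).1 a / mix θ τ a) = (θ i).1 a := by field_simp
      have h6 : τ.1 i * (mix θ τ a * ((θ i).1 a / mix θ τ a - 1) ^ 2) =
          τ.1 i * (mix θ τ a * ((θ i).1 a / mix θ τ a)) * ((θ i).1 a / mix θ τ a)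
            - 2 * τ.1 i * (mix θ τ a * ((θ i).1 a / mix θ τ a)) + τ.1 i * mix θ τ a := by ring
      rw [h6, h5]
      linarith
  rw [chiSq, Finset.mul_sum]
  refine (Finset.sum_le_sum fun a _ => h a).trans_eq ?_
  rw [Finset.sum_add_distrib, Finset.sum_sub_distrib, ← Finset.mul_sum, ← Finset.mul_sum, sum_mix,
    (θ i).2.2]
  ring

theorem Q_nonneg (θ : Advice N K) (τ : stdSimplex ℝ (Fin N)) : 0 ≤ Q θ τ :=
  Finset.sum_nonneg fun i _ => mul_nonneg (τ.2.1 i) (chiSq_nonneg (mix_nonneg θ τ))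

/-- Besides its value, this supplies the boundedness without which the real supremum in `capacity`
would take its default value. -/
theorem Q_le (θ : Advice N K) (τ : stdSimplex ℝ (Fin N)) : Q θ τ ≤ N - 1 := by
  refine (Finset.sum_le_sum fun i _ => weight_mul_chiSq_le θ τ i).trans_eq ?_
  simp [Finset.sum_sub_distrib, τ.2.2]

theorem Q_le_capacity (θ : Advice N K) (τ : stdSimplex ℝ (Fin N)) : Q θ τ ≤ capacity θ :=
  le_ciSup (f := fun τ => Q θ τ) ⟨(N : ℝ) - 1, by rintro _ ⟨τ, rfl⟩; exact Q_le θ τ⟩ τ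

/-- Weighted sums of chi-squared divergences, bounded by the tangent of `x ↦ x ^ q` at `X`. -/
theorem sum_rpow_mul_chiSq_le (θ : Advice N K) (p : stdSimplex ℝ (Fin N)) {q X : ℝ} (hq0 : 0 < q)
    (hq1 : q < 1) (hX : 0 < X) :
    ∑ i, p.1 i ^ (2 - q) * chiSq (θ i).1 (mix θ p) ≤
      (1 - q) * X ^ q + q * X ^ (q - 1) * Q θ p := by
  have key : ∀ i, p.1 i ^ (2 - q) * chiSq (θ i).1 (mix θ p) ≤
      (1 - q) * X ^ q * p.1 i + q * X ^ (q - 1) * (p.1 i * chiSq (θ i).1 (mix θ p)) := by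
    intro i
    have hp := p.2.1 i
    have hchi : 0 ≤ chiSq (θ i).1 (mix θ p) := chiSq_nonneg (mix_nonneg θ p)
    set c := chiSq (θ i).1 (mix θ p)
    have hw1 : p.1 i * c ≤ 1 := by have := weight_mul_chiSq_le θ p i; linarith
    have hw0 : 0 ≤ p.1 i * c := mul_nonneg hp hchi
    rcases hw0.eq_or_lt with h0 | h0
    · have : p.1 i ^ (2 - q) * c = 0 := by
        rcases mul_eq_zero.1 h0.symm with h | h
        · rw [h, Real.zero_rpow (by linarith), zero_mul]
        · rw [h, mul_zero]
      rw [this, ← h0]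
      have := Real.rpow_pos_of_pos hX q
      have : 0 ≤ 1 - q := by linarith
      positivity
    set w := p.1 i * c with hw
    have hp' : 0 < p.1 i := hp.lt_of_ne fun h => by rw [hw, ← h] at h0; simp at h0
    -- With `w = p_i χ²_i`, the summand factors as `w^q (w p_i)^(1-q)`. Weighted AM-GM applied to `w
    -- / X` and `w p_i`, followed by `w ≤ 1` in the second term, is linear in `w` and `p_i`.
    have amgm := Real.geom_mean_le_arith_mean2_weighted hq0.le (by linarith : 0 ≤ 1 - q)
      (div_nonneg h0.le hX.le) (mul_nonneg h0.le hp) (by ring)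
    have e1 : p.1 i ^ (2 - q) * c = X ^ q * ((w / X) ^ q * (w * p.1 i) ^ (1 - q)) := by
      rw [Real.div_rpow h0.le hX.le, Real.mul_rpow h0.le hp,
        show (2 : ℝ) - q = 1 + (1 - q) by ring, Real.rpow_add hp', Real.rpow_one]
      have hw' : w ^ q * w ^ (1 - q) = w := by rw [← Real.rpow_add h0]; simp
      have hXq := (Real.rpow_pos_of_pos hX q).ne'
      calc _ = w * p.1 i ^ (1 - q) := by rw [hw]; ring
        _ = (w ^ q * w ^ (1 - q)) * p.1 i ^ (1 - q) := by rw [hw']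
        _ = _ := by field_simp
    have e2 : X ^ (q - 1) = X ^ q / X := by rw [Real.rpow_sub hX, Real.rpow_one]
    rw [e1, e2]
    calc _ ≤ X ^ q * (q * (w / X) + (1 - q) * (w * p.1 i)) := by gcongr
      _ ≤ X ^ q * (q * (w / X) + (1 - q) * (1 * p.1 i)) := by
        have : 0 ≤ 1 - q := by linarith
        gcongr
      _ = _ := by ring
  refine (Finset.sum_le_sum fun i _ => key i).trans_eq ?_
  rw [Finset.sum_add_distrib, ← Finset.mul_sum, ← Finset.mul_sum, p.2.2, mul_one, Q]

variable [NeZero N]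

theorem capacity_le (θ : Advice N K) : capacity θ ≤ N - 1 :=
  ciSup_le fun τ => Q_le θ τ

theorem capacity_nonneg (θ : Advice N K) : 0 ≤ capacity θ :=
  (Q_nonneg θ (uniform N)).trans (Q_le_capacity θ _)

theorem avgCapacity_le {T : ℕ} (hT : 0 < T) (θ : ℕ → Advice N K) : avgCapacity T θ ≤ N := by
  have h : ∑ t ∈ Finset.range T, capacity (θ t) ≤ ∑ _t ∈ Finset.range T, (N : ℝ) :=
    Finset.sum_le_sum fun t _ => (capacity_le (θ t)).trans (by linarith)
  rw [avgCapacity, one_div_mul_eq_div, div_le_iff₀ (by exact_mod_cast hT)]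
  simpa [mul_comm] using h

end

/-! ### Tsallis entropy: optimality and stability of the regularized leader. -/

section

/-- The tangent of the concave function `u ↦ u ^ q` at `c`. -/
theorem rpow_le_tangent {q u c : ℝ} (hq0 : 0 ≤ q) (hq1 : q ≤ 1) (hu : 0 ≤ u) (hc : 0 < c) :
    u ^ q ≤ (1 - q) * c ^ q + q * c ^ (q - 1) * u := by
  have h := rpow_one_add_le_one_add_mul_self (s := u / c - 1) (p := q)
    (by have := div_nonneg hu hc.le; linarith) hq0 hq1
  rw [add_sub_cancel, Real.div_rpow hu hc.le, div_le_iff₀ (Real.rpow_pos_of_pos hc q)] at h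
  rw [Real.rpow_sub hc, Real.rpow_one]
  refine h.trans_eq ?_
  field_simp
  ring

/-- Second-order upper bound for `v ↦ v ^ (-b)` around `1`. -/
theorem rpow_neg_le_quadratic {b v : ℝ} (hb : 0 < b) (hv : Real.exp (-(1 / (b + 2))) ≤ v) :
    v ^ (-b) ≤ 1 - b * (v - 1) + Real.exp 1 * (b * (b + 1)) / 2 * (v - 1) ^ 2 := by
  set v₀ := Real.exp (-(1 / (b + 2)))
  have hv₀ : 0 < v₀ := Real.exp_pos _
  have hv₁ : v₀ ≤ 1 := Real.exp_le_one_iff.2 (by have : 0 ≤ 1 / (b + 2) := by positivity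
                                                 linarith)
  let f : ℝ → ℝ := fun v =>
    1 - b * (v - 1) + Real.exp 1 * (b * (b + 1)) / 2 * (v - 1) ^ 2 - v ^ (-b)
  let f' : ℝ → ℝ := fun v => -b + Real.exp 1 * (b * (b + 1)) * (v - 1) + b * v ^ (-b - 1)
  let f'' : ℝ → ℝ := fun v => Real.exp 1 * (b * (b + 1)) - b * (b + 1) * v ^ (-b - 2)
  have hf : ∀ v, 0 < v → HasDerivAt f (f' v) v := by
    intro v hv
    have h1 := (hasDerivAt_id v).sub_const 1
    have h2 := ((h1.const_mul b).const_sub 1).add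
      ((h1.pow 2).const_mul (Real.exp 1 * (b * (b + 1)) / 2))
    refine (h2.sub (Real.hasDerivAt_rpow_const (p := -b) (Or.inl hv.ne'))).congr_deriv ?_
    simp only [f', id]
    push_cast
    ring
  have hf' : ∀ v, 0 < v → HasDerivAt f' (f'' v) v := by
    intro v hv
    have h1 := (hasDerivAt_id v).sub_const 1
    have h2 := ((h1.const_mul (Real.exp 1 * (b * (b + 1)))).const_add (-b)).add
      ((Real.hasDerivAt_rpow_const (p := -b - 1) (Or.inl hv.ne')).const_mul b)
    refine h2.congr_deriv ?_
    simp only [f'']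
    rw [show -b - 1 - 1 = -b - 2 by ring]
    ring
  have hf''_nonneg : ∀ v, v₀ ≤ v → 0 ≤ f'' v := by
    intro v hv
    have h1 : v ^ (-b - 2) ≤ v₀ ^ (-b - 2) :=
      Real.rpow_le_rpow_of_nonpos hv₀ hv (by linarith)
    -- The threshold `v₀` is chosen so that the second derivative of `v ^ (-b)` there is exactly `e`
    -- times its value at `1`.
    have h2 : v₀ ^ (-b - 2) = Real.exp 1 := by
      rw [← Real.exp_mul]
      congr 1
      field_simp
      ring
    have h3 : 0 < b * (b + 1) := by positivity
    simp only [f'']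
    rw [h2] at h1
    nlinarith
  have hmono : MonotoneOn f' (Set.Ici v₀) := by
    refine monotoneOn_of_deriv_nonneg (convex_Ici _)
      (fun v hv => (hf' v (hv₀.trans_le hv)).continuousAt.continuousWithinAt) ?_ ?_
    · intro v hv
      rw [interior_Ici] at hv
      exact (hf' v (hv₀.trans hv)).differentiableAt.differentiableWithinAt
    · intro v hv
      rw [interior_Ici] at hv
      rw [(hf' v (hv₀.trans hv)).deriv]
      exact hf''_nonneg v (le_of_lt hv)
  have hf'1 : f' 1 = 0 := by simp [f']
  have hf1 : f 1 = 0 := by simp [f]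
  suffices h : 0 ≤ f v by simp only [f] at h; linarith
  rw [← hf1]
  rcases le_total v 1 with h | h
  · have hanti : AntitoneOn f (Set.Icc v₀ 1) := by
      refine antitoneOn_of_deriv_nonpos (convex_Icc _ _)
        (fun v hv => (hf v (hv₀.trans_le hv.1)).continuousAt.continuousWithinAt) ?_ ?_
      · intro v hv
        rw [interior_Icc] at hv
        exact (hf v (hv₀.trans hv.1)).differentiableAt.differentiableWithinAt
      · intro v hv
        rw [interior_Icc] at hv
        rw [(hf v (hv₀.trans hv.1)).deriv, ← hf'1]
        exact hmono hv.1.le hv₁ hv.2.le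
    exact hanti ⟨hv, h⟩ ⟨hv₁, le_rfl⟩ h
  · have hmon : MonotoneOn f (Set.Ici 1) := by
      refine monotoneOn_of_deriv_nonneg (convex_Ici _)
        (fun v hv => (hf v (one_pos.trans_le hv)).continuousAt.continuousWithinAt) ?_ ?_
      · intro v hv
        rw [interior_Ici] at hv
        exact (hf v (one_pos.trans hv)).differentiableAt.differentiableWithinAt
      · intro v hv
        rw [interior_Ici] at hv
        rw [(hf v (one_pos.trans hv)).deriv, ← hf'1]
        exact hmono hv₁ (hv₁.trans (le_of_lt hv)) (le_of_lt hv)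
    exact hmon (Set.mem_Ici.2 le_rfl) h h

variable {N : ℕ}

theorem tsallis_uniform_le [NeZero N] {q : ℝ} (hq0 : 0 < q) (hq1 : q < 1)
    (p : stdSimplex ℝ (Fin N)) : tsallis q (uniform N).1 ≤ tsallis q p.1 := by
  have hN : (0 : ℝ) < N := by exact_mod_cast Nat.pos_of_ne_zero (NeZero.ne N)
  have h1 : ∑ i, p.1 i ^ q ≤ ∑ i, (uniform N).1 i ^ q := by
    refine (Finset.sum_le_sum fun i _ =>
      rpow_le_tangent hq0.le hq1.le (p.2.1 i) (one_div_pos.2 hN)).trans_eq ?_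
    rw [Finset.sum_add_distrib]
    simp only [← Finset.mul_sum]
    rw [p.2.2, Real.rpow_sub (one_div_pos.2 hN), Real.rpow_one]
    simp only [uniform, Finset.sum_const, Finset.card_univ, Fintype.card_fin, nsmul_eq_mul]
    field_simp
    ring
  have h2 : 0 < 1 / (1 - q) := one_div_pos.2 (by linarith)
  unfold tsallis
  gcongr

theorem tsallis_uniform [NeZero N] (q : ℝ) :
    tsallis q (uniform N).1 = -(((N : ℝ) ^ (1 - q) - 1) / (1 - q)) := by
  have hN : (0 : ℝ) < N := by exact_mod_cast Nat.pos_of_ne_zero (NeZero.ne N)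
  simp only [tsallis, uniform, Finset.sum_const, Finset.card_univ, Fintype.card_fin, nsmul_eq_mul]
  rw [Real.div_rpow zero_le_one hN.le, Real.one_rpow, Real.rpow_sub hN, Real.rpow_one]
  ring

theorem ftrlObjective_zero (q η : ℝ) (p : stdSimplex ℝ (Fin N)) :
    ftrlObjective q η 0 p = tsallis q p.1 := by
  simp [ftrlObjective]

theorem ftrl_spec [NeZero N] {q : ℝ} (hq : 0 < q) (η : ℝ) (Y : Fin N → ℝ)
    (p' : stdSimplex ℝ (Fin N)) :
    ftrlObjective q η Y (ftrl q η Y) ≤ ftrlObjective q η Y p' :=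
  Classical.epsilon_spec (exists_ftrl_min hq η Y) p'

/-- The minimizer lies in the interior of the simplex. -/
theorem ftrl_min_pos [NeZero N] {q η : ℝ} (hq0 : 0 < q) (hq1 : q < 1) {Y : Fin N → ℝ}
    {p : stdSimplex ℝ (Fin N)} (hp : ∀ p', ftrlObjective q η Y p ≤ ftrlObjective q η Y p')
    (j : Fin N) : 0 < p.1 j := by
  refine (p.2.1 j).lt_of_ne fun hj => ?_
  have hN : (0 : ℝ) < N := by exact_mod_cast Nat.pos_of_ne_zero (NeZero.ne N)
  set A : ℝ := η * (∑ i, Y i * ((uniform N).1 i - p.1 i)) + 1 / (1 - q) * ∑ i, p.1 i ^ q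
  have h1q : 0 < 1 - q := by linarith
  -- If `p_j = 0`, moving by `δ` towards the uniform point gains order `δ^q` in entropy at a price
  -- of order `δ`. Optimality forbids this, and dividing by `δ^q` leaves a bound that fails as `δ →
  -- 0`.
  have key : ∀ δ : ℝ, 0 < δ → δ < 1 → 1 / (1 - q) * (1 / (N : ℝ)) ^ q ≤ A * δ ^ (1 - q) := by
    intro δ h0 h1
    let p' : stdSimplex ℝ (Fin N) := ⟨(1 - δ) • p.1 + δ • (uniform N).1,
      convex_stdSimplex ℝ (Fin N) p.2 (uniform N).2 (by linarith) h0.le (by ring)⟩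
    have hp' : ∀ i, p'.1 i = (1 - δ) * p.1 i + δ * (1 / (N : ℝ)) := fun i => rfl
    have e1 : (1 - δ) * ∑ i, p.1 i ^ q + (δ * (1 / (N : ℝ))) ^ q ≤ ∑ i, p'.1 i ^ q := by
      have h2 : ∀ i, (1 - δ) * p.1 i ^ q + (if i = j then (δ * (1 / (N : ℝ))) ^ q else 0) ≤
          p'.1 i ^ q := by
        intro i
        rw [hp']
        have hδN : 0 < δ * (1 / (N : ℝ)) := by positivity
        split_ifs with hij
        · rw [hij, ← hj, Real.zero_rpow hq0.ne']
          simp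
        · rw [add_zero]
          have h3 : 1 - δ ≤ (1 - δ) ^ q :=
            Real.self_le_rpow_of_le_one (by linarith) (by linarith) hq1.le
          have h4 := p.2.1 i
          calc _ ≤ (1 - δ) ^ q * p.1 i ^ q :=
                mul_le_mul_of_nonneg_right h3 (Real.rpow_nonneg h4 q)
            _ = ((1 - δ) * p.1 i) ^ q := (Real.mul_rpow (by linarith) h4).symm
            _ ≤ _ := Real.rpow_le_rpow (mul_nonneg (by linarith) h4) (by linarith) hq0.le
      have := Finset.sum_le_sum fun i (_ : i ∈ Finset.univ) => h2 i
      rwa [Finset.sum_add_distrib, ← Finset.mul_sum, Finset.sum_ite_eq' Finset.univ j,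
        if_pos (Finset.mem_univ j)] at this
    have e2 : ∑ i, Y i * p'.1 i = ∑ i, Y i * p.1 i +
        δ * ∑ i, Y i * ((uniform N).1 i - p.1 i) := by
      rw [Finset.mul_sum, ← Finset.sum_add_distrib]
      refine Finset.sum_congr rfl fun i _ => ?_
      rw [hp']
      simp only [uniform]
      ring
    have h5 := hp p'
    simp only [ftrlObjective, tsallis] at h5
    rw [e2] at h5
    have h6 : 1 / (1 - q) * ((1 - δ) * ∑ i, p.1 i ^ q + (δ * (1 / (N : ℝ))) ^ q) ≤
        1 / (1 - q) * ∑ i, p'.1 i ^ q := by gcongr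
    have h7 : 1 / (1 - q) * (δ * (1 / (N : ℝ))) ^ q ≤ δ * A := by
      simp only [A]
      linarith
    rw [Real.mul_rpow h0.le (by positivity)] at h7
    rw [Real.rpow_sub h0, Real.rpow_one, mul_div_assoc', le_div_iff₀ (Real.rpow_pos_of_pos h0 q)]
    linarith
  have hlim : Filter.Tendsto (fun δ : ℝ => A * δ ^ (1 - q)) (nhdsWithin 0 (Set.Ioi 0))
      (nhds 0) := by
    have := ((Real.continuous_rpow_const h1q.le).tendsto 0).const_mul A
    rw [Real.zero_rpow h1q.ne', mul_zero] at this
    exact this.mono_left nhdsWithin_le_nhds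
  have := ge_of_tendsto hlim (Filter.eventually_of_mem
    (Ioo_mem_nhdsGT (zero_lt_one' ℝ)) fun δ hδ => key δ hδ.1 hδ.2)
  have : 0 < 1 / (1 - q) * (1 / (N : ℝ)) ^ q := by positivity
  linarith

/-- First-order optimality of the minimizer. -/
theorem ftrl_min_variational [NeZero N] {q η : ℝ} (hq0 : 0 < q) (hq1 : q < 1) {Y : Fin N → ℝ}
    {p : stdSimplex ℝ (Fin N)} (hp : ∀ p', ftrlObjective q η Y p ≤ ftrlObjective q η Y p')
    (p' : stdSimplex ℝ (Fin N)) :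
    0 ≤ ∑ i, (η * Y i - q / (1 - q) * p.1 i ^ (q - 1)) * (p'.1 i - p.1 i) := by
  let φ : ℝ → ℝ := fun δ => η * ∑ i, Y i * (p.1 i + δ * (p'.1 i - p.1 i)) +
    1 / (1 - q) * (1 - ∑ i, (p.1 i + δ * (p'.1 i - p.1 i)) ^ q)
  have hd : HasDerivAt φ (∑ i, (η * Y i - q / (1 - q) * p.1 i ^ (q - 1)) * (p'.1 i - p.1 i)) 0 := by
    have h1 : ∀ i, HasDerivAt (fun δ : ℝ => p.1 i + δ * (p'.1 i - p.1 i)) (p'.1 i - p.1 i) 0 :=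
      fun i => by simpa using ((hasDerivAt_id (0 : ℝ)).mul_const (p'.1 i - p.1 i)).const_add (p.1 i)
    have h2 : ∀ i, HasDerivAt (fun δ : ℝ => (p.1 i + δ * (p'.1 i - p.1 i)) ^ q)
        ((p'.1 i - p.1 i) * q * p.1 i ^ (q - 1)) 0 := fun i => by
      have := (h1 i).rpow_const (p := q) (Or.inl (by simpa using (ftrl_min_pos hq0 hq1 hp i).ne'))
      simpa using this
    have h3 := ((HasDerivAt.fun_sum fun i (_ : i ∈ Finset.univ) =>
      (h1 i).const_mul (Y i)).const_mul η).add
      (((HasDerivAt.fun_sum fun i (_ : i ∈ Finset.univ) => h2 i).const_sub 1).const_mul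
        (1 / (1 - q)))
    refine h3.congr_deriv ?_
    rw [← Finset.sum_neg_distrib, Finset.mul_sum, Finset.mul_sum, ← Finset.sum_add_distrib]
    refine Finset.sum_congr rfl fun i _ => ?_
    ring
  have hlim := hd.tendsto_slope_zero_right
  refine ge_of_tendsto hlim (Filter.eventually_of_mem (Ioo_mem_nhdsGT (zero_lt_one' ℝ)) ?_)
  rintro δ ⟨h0, h1⟩
  let x : stdSimplex ℝ (Fin N) := ⟨(1 - δ) • p.1 + δ • p'.1,
      convex_stdSimplex ℝ (Fin N) p.2 p'.2 (by linarith) h0.le (by ring)⟩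
  have hx : ∀ i, x.1 i = p.1 i + δ * (p'.1 i - p.1 i) := fun i => by
    change (1 - δ) * p.1 i + δ * p'.1 i = _
    ring
  have h2 := hp x
  simp only [ftrlObjective, tsallis, hx] at h2
  simp only [φ, zero_add, smul_eq_mul, zero_mul, add_zero]
  exact mul_nonneg (inv_nonneg.2 h0.le) (by linarith)

/-- The one-coordinate estimate behind `ftrl_stability`. -/
theorem coordinate_stability {q η s z u : ℝ} (hq0 : 0 < q) (hq1 : q < 1) (hη : 0 < η)
    (hη' : η ≤ q / (1 - q) * (1 - Real.exp ((q - 1) / (2 - q)))) (hs0 : 0 < s) (hs1 : s ≤ 1)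
    (hz : -1 ≤ z) (hu : 0 ≤ u) :
    -(1 / (1 - q) * s ^ q) + η * z * s
        - Real.exp 1 * η ^ 2 / (2 * q) * (s ^ (2 - q) * z ^ 2) ≤
      η * z * u + q / (1 - q) * s ^ (q - 1) * (u - s) - 1 / (1 - q) * u ^ q := by
  have h1q : 0 < 1 - q := by linarith
  set b := q / (1 - q) with hb
  have hb0 : 0 < b := by positivity
  -- Relative change of the entropy gradient `q / (1 - q) * s ^ (q - 1)` caused by `η z`. The cap on
  -- `η`, with `z ≥ -1` and `s ≤ 1`, is exactly what keeps `1 + w` above the threshold of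
  -- `rpow_neg_le_quadratic` for `b = q / (1 - q)`.
  set w := η * z * (1 - q) * s ^ (1 - q) / q with hw
  have hs1q0 : 0 < s ^ (1 - q) := Real.rpow_pos_of_pos hs0 _
  have hs1q1 : s ^ (1 - q) ≤ 1 := Real.rpow_le_one hs0.le hs1 h1q.le
  have hv : Real.exp (-(1 / (b + 2))) ≤ 1 + w := by
    have e1 : -(1 / (b + 2)) = (q - 1) / (2 - q) := by
      have h2q : 2 - q ≠ 0 := by linarith
      have : b + 2 = (2 - q) / (1 - q) := by rw [hb]; field_simp; ring
      rw [this]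
      field_simp
      ring
    rw [e1]
    have e2 : η * (1 - q) / q ≤ 1 - Real.exp ((q - 1) / (2 - q)) := by
      rw [div_le_iff₀ hq0]
      calc η * (1 - q) ≤ b * (1 - Real.exp ((q - 1) / (2 - q))) * (1 - q) := by gcongr
        _ = _ := by rw [hb]; field_simp
    have e3 : w = η * (1 - q) / q * (z * s ^ (1 - q)) := by rw [hw]; ring
    have e4 : -1 ≤ z * s ^ (1 - q) := by nlinarith
    have e5 : 0 < η * (1 - q) / q := by positivity
    rw [e3]
    nlinarith
  have hv0 : 0 < 1 + w := (Real.exp_pos _).trans_le hv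
  have quad := rpow_neg_le_quadratic hb0 hv
  -- The stationary point in `u` of the right-hand side; the tangent of `u ^ q` at `c` cancels its
  -- linear part, leaving a function of `w` alone.
  set c := s * (1 + w) ^ (-(1 / (1 - q))) with hc
  have hc0 : 0 < c := mul_pos hs0 (Real.rpow_pos_of_pos hv0 _)
  have tang := rpow_le_tangent hq0.le hq1.le hu hc0
  have c1 : c ^ q = s ^ q * (1 + w) ^ (-b) := by
    rw [hc, Real.mul_rpow hs0.le (Real.rpow_nonneg hv0.le _), ← Real.rpow_mul hv0.le]
    congr 2
    rw [hb]
    ring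
  have c2 : c ^ (q - 1) = s ^ (q - 1) * (1 + w) := by
    rw [hc, Real.mul_rpow hs0.le (Real.rpow_nonneg hv0.le _), ← Real.rpow_mul hv0.le]
    congr 1
    rw [show -(1 / (1 - q)) * (q - 1) = 1 by field_simp; ring, Real.rpow_one]
  rw [c1, c2] at tang
  set σ := s ^ q with hσ
  have hσ0 : 0 < σ := Real.rpow_pos_of_pos hs0 _
  have s1 : s ^ (q - 1) = σ / s := by rw [Real.rpow_sub hs0, Real.rpow_one]
  have s2 : s ^ (1 - q) = s / σ := by rw [Real.rpow_sub hs0, Real.rpow_one]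
  have s3 : s ^ (2 - q) = s ^ 2 / σ := by
    rw [hσ, Real.rpow_sub hs0]
    norm_num
  rw [s2] at hw
  have t1 : 1 / (1 - q) * u ^ q ≤ σ * (1 + w) ^ (-b) + b * (σ / s) * (1 + w) * u := by
    rw [s1] at tang
    calc 1 / (1 - q) * u ^ q ≤ 1 / (1 - q) *
          ((1 - q) * (σ * (1 + w) ^ (-b)) + q * (σ / s * (1 + w)) * u) := by gcongr
      _ = _ := by rw [hb]; field_simp
  have t2 : σ * (1 + w) ^ (-b) ≤
      σ * (1 - b * (1 + w - 1) + Real.exp 1 * (b * (b + 1)) / 2 * (1 + w - 1) ^ 2) := by gcongr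
  have t3 : b * (σ / s) * w = η * z := by
    rw [hw, hb]
    field_simp
  have t4 : σ * (Real.exp 1 * (b * (b + 1)) / 2 * (1 + w - 1) ^ 2) =
      Real.exp 1 * η ^ 2 / (2 * q) * (s ^ (2 - q) * z ^ 2) := by
    rw [s3, hw, hb]
    field_simp
    ring
  have t5 : σ * (b * w) = η * z * s := by rw [← t3]; field_simp
  have t6 : 1 / (1 - q) * σ = σ + b * (σ / s) * s := by
    rw [hb]
    field_simp
    ring
  rw [s1, ← t4]
  have t7 : b * (σ / s) * (1 + w) * u = b * (σ / s) * u + η * z * u := by rw [← t3]; ring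
  nlinarith

/-- Stability of the regularized leader under a perturbation `z` of the cumulative loss. -/
theorem ftrl_stability [NeZero N] {q η : ℝ} (hq0 : 0 < q) (hq1 : q < 1) (hη : 0 < η)
    (hη' : η ≤ q / (1 - q) * (1 - Real.exp ((q - 1) / (2 - q)))) {Y : Fin N → ℝ}
    {p : stdSimplex ℝ (Fin N)} (hp : ∀ p', ftrlObjective q η Y p ≤ ftrlObjective q η Y p')
    (z : Fin N → ℝ) (hz : ∀ i, -1 ≤ z i) (hpz : ∑ i, p.1 i * z i = 0)
    (p' : stdSimplex ℝ (Fin N)) :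
    ftrlObjective q η Y p ≤ ftrlObjective q η (fun i => Y i + z i) p' +
      Real.exp 1 * η ^ 2 / (2 * q) * ∑ i, p.1 i ^ (2 - q) * z i ^ 2 := by
  have h1 := ftrl_min_variational hq0 hq1 hp p'
  have h2 := Finset.sum_le_sum fun i (_ : i ∈ Finset.univ) =>
    coordinate_stability hq0 hq1 hη hη' (ftrl_min_pos hq0 hq1 hp i)
      ((Finset.single_le_sum (fun j _ => p.2.1 j) (Finset.mem_univ i)).trans_eq p.2.2)
      (hz i) (p'.2.1 i)
  -- Centring removes the first-order term, so only the quadratic one survives.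
  have h3 : ∑ i, η * z i * p.1 i = 0 := by
    rw [← mul_zero η, ← hpz, Finset.mul_sum]
    exact Finset.sum_congr rfl fun i _ => by ring
  have h4 : ∑ i, (η * Y i - q / (1 - q) * p.1 i ^ (q - 1)) * (p'.1 i - p.1 i) =
      η * (∑ i, Y i * p'.1 i) - η * (∑ i, Y i * p.1 i) -
        ∑ i, q / (1 - q) * p.1 i ^ (q - 1) * (p'.1 i - p.1 i) := by
    rw [Finset.mul_sum, Finset.mul_sum, ← Finset.sum_sub_distrib, ← Finset.sum_sub_distrib]
    exact Finset.sum_congr rfl fun i _ => by ring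
  have h5 : ∑ i, (Y i + z i) * p'.1 i = ∑ i, Y i * p'.1 i + ∑ i, z i * p'.1 i := by
    rw [← Finset.sum_add_distrib]
    exact Finset.sum_congr rfl fun i _ => by ring
  have h6 : ∑ i, η * z i * p'.1 i = η * ∑ i, z i * p'.1 i := by
    rw [Finset.mul_sum]
    exact Finset.sum_congr rfl fun i _ => by ring
  rw [Finset.sum_sub_distrib, Finset.sum_add_distrib, Finset.sum_neg_distrib, h3,
    Finset.sum_sub_distrib, Finset.sum_add_distrib, h6, ← Finset.mul_sum, ← Finset.mul_sum,
    ← Finset.mul_sum] at h2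
  simp only [ftrlObjective, tsallis]
  rw [h5]
  linarith

end

/-! ### The logarithmic factor and the cost of an epoch. -/

/-- The logarithmic factor `ln (e² N / (x ∨ 1))` of the regret bound. -/
def logFactor (N : ℕ) (x : ℝ) : ℝ := Real.log (Real.exp 1 ^ 2 * N / max x 1)

/-- The range `(N ^ (1 - q) - 1) / (1 - q)` of the Tsallis entropy for `q = q_r`. -/
def entropyRange (N : ℕ) (r : ℤ) : ℝ :=
  ((N : ℝ) ^ (1 - qParam N r) - 1) / (1 - qParam N r)

/-- Bound on the regret between two restarts, while the exponent is `r`. -/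
def epochCost (N T : ℕ) (r : ℤ) : ℝ :=
  entropyRange N r / etaParam N T r +
    Real.exp 1 * etaParam N T r / (2 * qParam N r) * (T * ((2 : ℝ) ^ (r + 1)) ^ qParam N r)

theorem logFactor_eq {N : ℕ} (hN : 0 < N) (x : ℝ) :
    logFactor N x = 2 + Real.log N - Real.log (max x 1) := by
  have h1 : (0 : ℝ) < N := by exact_mod_cast hN
  have h2 : 0 < max x 1 := lt_max_of_lt_right one_pos
  rw [logFactor, Real.log_div (by positivity) h2.ne', Real.log_mul (by positivity) h1.ne',
    Real.log_pow, Real.log_exp]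
  norm_num

theorem two_le_logFactor {N : ℕ} (hN : 0 < N) {x : ℝ} (hx : x ≤ N) : 2 ≤ logFactor N x := by
  rw [logFactor_eq hN]
  have h2 : 0 < max x 1 := lt_max_of_lt_right one_pos
  have : Real.log (max x 1) ≤ Real.log N :=
    Real.log_le_log h2 (max_le hx (by exact_mod_cast hN))
  linarith

theorem logFactor_of_le_one {N : ℕ} {x : ℝ} (hx : x ≤ 1) :
    logFactor N x = Real.log (Real.exp 1 ^ 2 * N) := by
  rw [logFactor, max_eq_right hx, div_one]

theorem logFactor_antitone {N : ℕ} (hN : 0 < N) {x y : ℝ} (hxy : x ≤ y) :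
    logFactor N y ≤ logFactor N x := by
  rw [logFactor_eq hN, logFactor_eq hN]
  have := Real.log_le_log (lt_max_of_lt_right one_pos : 0 < max x 1) (max_le_max_right 1 hxy)
  linarith

/-- From `ln u ≤ u - 1`, the loss `x (logFactor x - logFactor y)` is at most `y - x`, which the gain
`(y - x) * logFactor y` covers because the `e²` keeps the factor at least `2`. -/
theorem mul_logFactor_mono {N : ℕ} (hN : 0 < N) {x y : ℝ} (hx : 0 < x) (hxy : x ≤ y)
    (hy : y ≤ N) : x * logFactor N x ≤ y * logFactor N y := by
  have hx1 : 0 < max x 1 := lt_max_of_lt_right one_pos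
  have hy1 : 0 < max y 1 := lt_max_of_lt_right one_pos
  have h1 : logFactor N x - logFactor N y ≤ max y 1 / max x 1 - 1 := by
    rw [logFactor_eq hN, logFactor_eq hN]
    have := Real.log_le_sub_one_of_pos (div_pos hy1 hx1)
    rw [Real.log_div hy1.ne' hx1.ne'] at this
    linarith
  have h2 : x * (max y 1 / max x 1 - 1) ≤ y - x := by
    rcases le_total x 1 with h | h
    · rw [max_eq_right h, div_one]
      rcases le_total y 1 with h' | h'
      · rw [max_eq_right h']; linarith
      · rw [max_eq_left h']; nlinarith
    · rw [max_eq_left h, max_eq_left (h.trans hxy)]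
      have : x * (y / x - 1) = y - x := by field_simp
      linarith
  have h3 := two_le_logFactor hN hy
  nlinarith [mul_le_mul_of_nonneg_left h1 hx.le]

/-- Halving `x` adds at most `ln 2` to a factor that is at least `2`, so the ratio is at most `1/2 +
(ln 2)/4 ≈ 0.6733 < 0.821²`. This gives the geometric ratio of the epoch costs. -/
theorem half_mul_logFactor_le {N : ℕ} (hN : 0 < N) {x : ℝ} (hx : 0 < x) (hxN : x ≤ N) :
    x / 2 * logFactor N (x / 2) ≤ 0.821 ^ 2 * (x * logFactor N x) := by
  have h1 : logFactor N (x / 2) ≤ logFactor N x + Real.log 2 := by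
    rw [logFactor_eq hN, logFactor_eq hN]
    have h2 : max x 1 ≤ 2 * max (x / 2) 1 := by
      refine max_le ?_ ?_
      · linarith [le_max_left (x / 2) 1]
      · linarith [le_max_right (x / 2) 1]
    have h3 := Real.log_le_log (lt_max_of_lt_right one_pos : 0 < max x 1) h2
    rw [Real.log_mul two_ne_zero (lt_max_of_lt_right one_pos : 0 < max (x / 2) 1).ne'] at h3
    linarith
  have h2 := two_le_logFactor hN hxN
  have h3 := Real.log_two_lt_d9
  have h4 : logFactor N (x / 2) / 2 ≤ 0.821 ^ 2 * logFactor N x := by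
    norm_num at h3 ⊢
    linarith
  nlinarith

/-! ### The parameters `q_r`, `η_r` and the resulting epoch cost. -/

section Params

variable {N : ℕ} {r : ℤ}

theorem zpow_lt_of_le {R : ℤ} (hR : (2 : ℝ) ^ R < N) (h : r ≤ R) : (2 : ℝ) ^ r < N :=
  (zpow_le_zpow_right₀ one_le_two h).trans_lt hR

theorem log_ratio_pos (hr : (2 : ℝ) ^ r < N) : 0 < Real.log ((N : ℝ) / 2 ^ r) :=
  Real.log_pos ((one_lt_div (by positivity)).2 hr)

theorem half_lt_qParam (hr : (2 : ℝ) ^ r < N) : 1 / 2 < qParam N r := by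
  have h := log_ratio_pos hr
  have : 0 < Real.log ((N : ℝ) / 2 ^ r) /
    (Real.sqrt (Real.log ((N : ℝ) / 2 ^ r) ^ 2 + 4) + 2) := by positivity
  rw [qParam]
  linarith

theorem qParam_lt_one (hr : (2 : ℝ) ^ r < N) : qParam N r < 1 := by
  have h := log_ratio_pos hr
  have : Real.log ((N : ℝ) / 2 ^ r) /
      (Real.sqrt (Real.log ((N : ℝ) / 2 ^ r) ^ 2 + 4) + 2) < 1 := by
    rw [div_lt_one (by positivity)]
    have : Real.log ((N : ℝ) / 2 ^ r) ≤ Real.sqrt (Real.log ((N : ℝ) / 2 ^ r) ^ 2 + 4) :=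
      Real.le_sqrt_of_sq_le (by linarith)
    linarith
  rw [qParam]
  linarith

/-- The parameter `q_r` is the critical point of `q ↦ N ^ (1 - q) * (2 ^ r) ^ q / (q * (1 - q))`. -/
theorem log_ratio_mul_qParam (hr : (2 : ℝ) ^ r < N) :
    Real.log ((N : ℝ) / 2 ^ r) * (qParam N r * (1 - qParam N r)) = 2 * qParam N r - 1 := by
  have h := log_ratio_pos hr
  rw [qParam]
  set L := Real.log ((N : ℝ) / 2 ^ r)
  have hs : Real.sqrt (L ^ 2 + 4) ^ 2 = L ^ 2 + 4 := Real.sq_sqrt (by positivity)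
  have hs0 := Real.sqrt_nonneg (L ^ 2 + 4)
  set s := Real.sqrt (L ^ 2 + 4)
  have : s + 2 ≠ 0 := by positivity
  field_simp
  ring_nf
  linear_combination L * hs

/-- At the critical point, `(1 - q) ln (N / 2^r) = 2 - 1/q`, which is below `1`. -/
theorem rpow_ratio_le (hr : (2 : ℝ) ^ r < N) :
    ((N : ℝ) / 2 ^ r) ^ (1 - qParam N r) ≤ Real.exp 1 := by
  have h0 := half_lt_qParam hr
  have h1 := qParam_lt_one hr
  have h2 := log_ratio_mul_qParam hr
  have hx : (0 : ℝ) < 2 ^ r := by positivity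
  rw [Real.rpow_def_of_pos (div_pos (hx.trans hr) hx)]
  refine Real.exp_le_exp.2 ?_
  nlinarith

theorem natCast_rpow_mul_rpow (hr : (2 : ℝ) ^ r < N) :
    (N : ℝ) ^ (1 - qParam N r) * ((2 : ℝ) ^ r) ^ qParam N r ≤ Real.exp 1 * 2 ^ r := by
  have hx : (0 : ℝ) < 2 ^ r := by positivity
  have hN := hx.trans hr
  have h := rpow_ratio_le hr
  rw [Real.div_rpow hN.le hx.le, div_le_iff₀ (Real.rpow_pos_of_pos hx _)] at h
  calc _ ≤ Real.exp 1 * ((2 : ℝ) ^ r) ^ (1 - qParam N r) * ((2 : ℝ) ^ r) ^ qParam N r := by gcongr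
    _ = _ := by rw [mul_assoc, ← Real.rpow_add hx, sub_add_cancel, Real.rpow_one]

theorem entropyRange_pos (hN : 1 < N) (hr : (2 : ℝ) ^ r < N) : 0 < entropyRange N r := by
  have h1 := qParam_lt_one hr
  have : (1 : ℝ) < (N : ℝ) ^ (1 - qParam N r) :=
    Real.one_lt_rpow (by exact_mod_cast hN) (by linarith)
  exact div_pos (by linarith) (by linarith)

theorem entropyRange_mul_rpow_le (hN : 0 < N) (hr : (2 : ℝ) ^ r < N) :
    entropyRange N r * ((2 : ℝ) ^ r) ^ qParam N r ≤
      2 * qParam N r * Real.exp 1 * (2 ^ r * logFactor N (2 ^ r)) := by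
  have h0 := half_lt_qParam hr
  have h1 := qParam_lt_one hr
  have h2 := log_ratio_mul_qParam hr
  have h3 := natCast_rpow_mul_rpow hr
  have hx : (0 : ℝ) < 2 ^ r := by positivity
  have hN' := hx.trans hr
  have hlog := log_ratio_pos hr
  have hL : Real.log ((N : ℝ) / 2 ^ r) = Real.log N - Real.log (2 ^ r) :=
    Real.log_div hN'.ne' hx.ne'
  set q := qParam N r
  set x : ℝ := 2 ^ r
  have hxq : 0 < x ^ q := Real.rpow_pos_of_pos hx q
  have h1q : 0 < 1 - q := by linarith
  rw [entropyRange]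
  -- For `x ≥ 1` the `-1` in the entropy range may be dropped. For `x ≤ 1` that would yield `ln (N /
  -- x)`, unbounded as `x → 0`; keeping the `-1` gives `ln N` instead.
  rcases le_total 1 x with h | h
  · have e1 : logFactor N x = 2 + Real.log ((N : ℝ) / x) := by
      rw [logFactor_eq hN, max_eq_left h, hL]
      ring
    rw [e1]
    set L := Real.log ((N : ℝ) / x)
    have e2 : 1 / (1 - q) ≤ 2 * q * (2 + L) := by
      rw [div_le_iff₀ h1q]
      nlinarith
    calc ((N : ℝ) ^ (1 - q) - 1) / (1 - q) * x ^ q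
        = 1 / (1 - q) * ((N : ℝ) ^ (1 - q) * x ^ q - x ^ q) := by ring
      _ ≤ 1 / (1 - q) * (Real.exp 1 * x) := by gcongr; linarith
      _ ≤ 2 * q * (2 + L) * (Real.exp 1 * x) := by gcongr
      _ = _ := by ring
  · have hlogN : 0 ≤ Real.log N := Real.log_natCast_nonneg N
    rw [logFactor_eq hN, max_eq_right h, Real.log_one, sub_zero]
    have hy : 0 < (N : ℝ) ^ (1 - q) := Real.rpow_pos_of_pos hN' _
    have e1 : ((N : ℝ) ^ (1 - q) - 1) / (1 - q) ≤ (N : ℝ) ^ (1 - q) * Real.log N := by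
      rw [div_le_iff₀ h1q]
      have := Real.one_sub_inv_le_log_of_pos hy
      rw [Real.log_rpow hN'] at this
      have := mul_le_mul_of_nonneg_left this hy.le
      rw [mul_sub, mul_inv_cancel₀ hy.ne'] at this
      linarith
    calc _ ≤ (N : ℝ) ^ (1 - q) * Real.log N * x ^ q := by gcongr
      _ = Real.log N * ((N : ℝ) ^ (1 - q) * x ^ q) := by ring
      _ ≤ Real.log N * (Real.exp 1 * x) := by gcongr
      _ ≤ 2 * q * (2 + Real.log N) * (Real.exp 1 * x) := by
        gcongr
        nlinarith
      _ = _ := by ring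

/-- Dividing `entropyRange_mul_rpow_le` by `(2^r)^q` leaves `(2^r)^(1-q)`, and `1 - q < 1/2`. This
controls the penalty when the learning rate is capped. -/
theorem entropyRange_le (hN : 0 < N) (hr : (2 : ℝ) ^ r < N) :
    entropyRange N r ≤ 2 * qParam N r * Real.exp 1 *
      (max 1 (Real.sqrt (2 ^ r)) * logFactor N (2 ^ r)) := by
  have h0 := half_lt_qParam hr
  have h1 := qParam_lt_one hr
  have h2 := entropyRange_mul_rpow_le hN hr
  have h3 := two_le_logFactor hN hr.le
  set q := qParam N r
  have hx : (0 : ℝ) < 2 ^ r := by positivity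
  set x : ℝ := 2 ^ r
  have hxq : 0 < x ^ q := Real.rpow_pos_of_pos hx q
  have h4 : x ^ (1 - q) ≤ max 1 (Real.sqrt x) := by
    rcases le_total 1 x with h | h
    · refine le_max_of_le_right ?_
      rw [Real.sqrt_eq_rpow]
      exact Real.rpow_le_rpow_of_exponent_le h (by linarith)
    · exact le_max_of_le_left (Real.rpow_le_one hx.le h (by linarith))
  have h5 : x = x ^ (1 - q) * x ^ q := by rw [← Real.rpow_add hx]; simp
  have h6 : entropyRange N r ≤ 2 * q * Real.exp 1 * (x ^ (1 - q) * logFactor N x) := by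
    refine le_of_mul_le_mul_right (h2.trans_eq ?_) hxq
    nth_rw 1 [h5]
    ring
  refine h6.trans ?_
  gcongr

theorem le_rate_cap (hr : (2 : ℝ) ^ r < N) :
    5 / 6 * (qParam N r / (2 - qParam N r)) ≤ qParam N r / (1 - qParam N r) *
      (1 - Real.exp ((qParam N r - 1) / (2 - qParam N r))) := by
  have h0 := half_lt_qParam hr
  have h1 := qParam_lt_one hr
  set q := qParam N r
  have h1q : 0 < 1 - q := by linarith
  have h2q : 0 < 2 - q := by linarith
  set v := (1 - q) / (2 - q) with hv
  have hv0 : 0 < v := by positivity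
  -- From `q > 1/2`. On `[0, 1/3]` the quadratic lower bound for `exp v` just suffices for the slope
  -- `5/6`.
  have hv1 : v ≤ 1 / 3 := by rw [hv, div_le_iff₀ h2q]; linarith
  have e1 : (q - 1) / (2 - q) = -v := by rw [hv]; ring
  have e2 : 5 / 6 * v ≤ 1 - Real.exp (-v) := by
    have h := Real.quadratic_le_exp_of_nonneg hv0.le
    have h' : Real.exp (-v) * (1 + v + v ^ 2 / 2) ≤ 1 := by
      calc _ ≤ Real.exp (-v) * Real.exp v := by gcongr
        _ = 1 := by rw [← Real.exp_add]; simp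
    have hp := Real.exp_pos (-v)
    by_contra! hc
    have h3 : (1 - 5 / 6 * v) * (1 + v + v ^ 2 / 2) < Real.exp (-v) * (1 + v + v ^ 2 / 2) := by
      gcongr
      linarith
    nlinarith
  rw [e1]
  calc 5 / 6 * (q / (2 - q)) = q / (1 - q) * (5 / 6 * v) := by rw [hv]; field_simp
    _ ≤ _ := by gcongr

theorem etaParam_pos {T : ℕ} (hN : 1 < N) (hT : 0 < T) (hr : (2 : ℝ) ^ r < N) :
    0 < etaParam N T r := by
  have h0 := half_lt_qParam hr
  have h1 := qParam_lt_one hr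
  have h1q : 0 < 1 - qParam N r := by linarith
  have h2q : 0 < 2 - qParam N r := by linarith
  have hq : 0 < qParam N r := by linarith
  have hT' : (0 : ℝ) < T := by exact_mod_cast hT
  refine lt_min (Real.sqrt_pos.2 ?_) (lt_of_lt_of_le (by positivity) (le_rate_cap hr))
  have : (1 : ℝ) < (N : ℝ) ^ (1 - qParam N r) :=
    Real.one_lt_rpow (by exact_mod_cast hN) (by linarith)
  have : 0 < (N : ℝ) ^ (1 - qParam N r) - 1 := by linarith
  positivity

theorem epochCost_nonneg {T : ℕ} (hN : 1 < N) (hT : 0 < T) (hr : (2 : ℝ) ^ r < N) :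
    0 ≤ epochCost N T r := by
  have h0 := half_lt_qParam hr
  have hη := etaParam_pos hN hT hr
  have hD := entropyRange_pos hN hr
  have hq : 0 < qParam N r := by linarith
  unfold epochCost
  positivity

/-- The uncapped rate `√(D / g)` makes penalty and variance each at most `√(D g) ≤ 1.415 e s`; an
active cap adds at most `(18/5) e` times `max 1 √(2^r) * logFactor`. When `2^r T ≥ ln (e² N)` this
too is at most `(18/5) e s`, whence `6.43 = 2 * 1.415 + 3.6`. -/
theorem epochCost_le {T : ℕ} (hN : 1 < N) (hT : Real.log (Real.exp 1 ^ 2 * N) ≤ T)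
    (hr : (2 : ℝ) ^ r < N) :
    epochCost N T r ≤ 6.43 * Real.exp 1 * Real.sqrt (T * (2 ^ r * logFactor N (2 ^ r))) +
      if (2 : ℝ) ^ r * T < Real.log (Real.exp 1 ^ 2 * N) then
        18 * Real.exp 1 / 5 * Real.log (Real.exp 1 ^ 2 * N) else 0 := by
  have hN0 : 0 < N := by omega
  have h0 := half_lt_qParam hr
  have h1 := qParam_lt_one hr
  have hD := entropyRange_pos hN hr
  have hDx := entropyRange_mul_rpow_le hN0 hr
  have hDle := entropyRange_le hN0 hr
  have hcap := le_rate_cap hr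
  have hL2 := two_le_logFactor hN0 hr.le
  have hΛ : logFactor N 0 = Real.log (Real.exp 1 ^ 2 * N) := logFactor_of_le_one zero_le_one
  have hx : (0 : ℝ) < 2 ^ r := by positivity
  have hLΛ : logFactor N (2 ^ r) ≤ logFactor N 0 := logFactor_antitone hN0 hx.le
  rw [← hΛ] at hT ⊢
  have hT' : (0 : ℝ) < T := by linarith
  have hη := etaParam_pos hN (by exact_mod_cast hT') hr
  have hη1 : etaParam N T r ≤ _ := min_le_left _ _
  have hη2 := min_choice
    (Real.sqrt (qParam N r * ((N : ℝ) ^ (1 - qParam N r) - 1) /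
      (Real.exp 1 * T * (1 - qParam N r) * ((2 : ℝ) ^ r) ^ qParam N r)))
    (qParam N r / (1 - qParam N r) * (1 - Real.exp ((qParam N r - 1) / (2 - qParam N r))))
  change etaParam N T r = _ ∨ etaParam N T r = _ at hη2
  rw [epochCost, zpow_add_one₀ two_ne_zero, Real.mul_rpow hx.le zero_le_two]
  set q := qParam N r
  set η := etaParam N T r
  set D := entropyRange N r with hDdef
  set x : ℝ := 2 ^ r
  set L := logFactor N x
  have hq : 0 < q := by linarith
  have h1q : 0 < 1 - q := by linarith
  have h2q : 0 < 2 - q := by linarith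
  have hxq : 0 < x ^ q := Real.rpow_pos_of_pos hx q
  set g := Real.exp 1 * T * x ^ q / q with hg
  have hg0 : 0 < g := by positivity
  have hrate : q * ((N : ℝ) ^ (1 - q) - 1) / (Real.exp 1 * T * (1 - q) * x ^ q) = D / g := by
    rw [hDdef, entropyRange, hg]
    change _ = ((N : ℝ) ^ (1 - q) - 1) / (1 - q) / _
    field_simp
  rw [hrate, Real.sqrt_div hD.le] at hη1 hη2
  set a := Real.sqrt D
  set b := Real.sqrt g
  have ha : a ^ 2 = D := Real.sq_sqrt hD.le
  have hb : b ^ 2 = g := Real.sq_sqrt hg0.le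
  have ha0 : 0 < a := Real.sqrt_pos.2 hD
  have hb0 : 0 < b := Real.sqrt_pos.2 hg0
  set s := Real.sqrt (T * (x * L)) with hs
  have hL0 : 0 < L := by linarith
  have hab : a * b ≤ 1.415 * Real.exp 1 * s := by
    have e1 : (a * b) ^ 2 ≤ (1.415 * Real.exp 1 * s) ^ 2 := by
      have e2 : s ^ 2 = T * (x * L) := Real.sq_sqrt (by positivity)
      rw [mul_pow, ha, hb, mul_pow, e2, hg]
      calc D * (Real.exp 1 * T * x ^ q / q) = (D * x ^ q) * (Real.exp 1 * T / q) := by ring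
        _ ≤ (2 * q * Real.exp 1 * (x * L)) * (Real.exp 1 * T / q) := by gcongr
        _ = 2 * (Real.exp 1 ^ 2 * (T * (x * L))) := by field_simp
        _ ≤ (1.415 : ℝ) ^ 2 * (Real.exp 1 ^ 2 * (T * (x * L))) := by gcongr; norm_num
        _ = _ := by ring
    exact le_of_sq_le_sq e1 (by positivity)
  have hvar : Real.exp 1 * η / (2 * q) * (T * (x ^ q * 2 ^ q)) ≤ a * b := by
    have h2 : (2 : ℝ) ^ q ≤ 2 := by
      calc (2 : ℝ) ^ q ≤ 2 ^ (1 : ℝ) := Real.rpow_le_rpow_of_exponent_le one_le_two h1.le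
        _ = 2 := Real.rpow_one 2
    calc _ ≤ Real.exp 1 * (a / b) / (2 * q) * (T * (x ^ q * 2)) := by gcongr
      _ = g * (a / b) := by rw [hg]; field_simp
      _ = a * b := by rw [← hb]; field_simp
  have hpen : D / η ≤ a * b + D / (5 / 6 * (q / (2 - q))) := by
    have h2 : 0 < D / (5 / 6 * (q / (2 - q))) := by positivity
    rcases hη2 with h | h
    · rw [h, ← ha]
      have : a ^ 2 / (a / b) = a * b := by field_simp
      rw [ha] at this ⊢
      linarith
    · have : D / η ≤ D / (5 / 6 * (q / (2 - q))) := by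
        rw [h]
        gcongr
      have : 0 < a * b := by positivity
      linarith
  -- The constant is `2 * (6/5) * (2 - q) ≤ 18/5`, by `q > 1/2`.
  have hcapD : D / (5 / 6 * (q / (2 - q))) ≤
      18 * Real.exp 1 / 5 * (max 1 (Real.sqrt x) * L) := by
    rw [div_le_iff₀ (by positivity)]
    refine hDle.trans ?_
    have hm : 0 < Real.exp 1 * (max 1 (Real.sqrt x) * L) * q := by positivity
    have : 18 * Real.exp 1 / 5 * (max 1 (Real.sqrt x) * L) * (5 / 6 * (q / (2 - q))) =
        Real.exp 1 * (max 1 (Real.sqrt x) * L) * q * (3 / (2 - q)) := by field_simp; ring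
    rw [this]
    have h3 : 2 ≤ 3 / (2 - q) := by rw [le_div_iff₀ h2q]; linarith
    nlinarith
  have he := Real.exp_pos 1
  split_ifs with hlt
  · have hx1 : x ≤ 1 := by
      refine le_of_mul_le_mul_right (?_ : x * T ≤ 1 * T) hT'
      linarith
    have hLe : L = logFactor N 0 := by rw [hΛ]; exact logFactor_of_le_one hx1
    have : max 1 (Real.sqrt x) = 1 := max_eq_left (Real.sqrt_le_one.2 hx1)
    rw [this, one_mul, hLe] at hcapD
    have : 0 ≤ Real.exp 1 * s := by positivity
    linarith
  · push Not at hlt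
    have hmax : max 1 (Real.sqrt x) * L ≤ s := by
      rw [hs]
      refine Real.le_sqrt_of_sq_le ?_
      rcases le_total x 1 with hx1 | hx1
      · rw [max_eq_left (Real.sqrt_le_one.2 hx1), one_mul]
        calc L ^ 2 = L * L := sq L
          _ ≤ (x * T) * L := by gcongr; linarith
          _ = T * (x * L) := by ring
      · rw [max_eq_right (Real.one_le_sqrt.2 hx1), mul_pow, Real.sq_sqrt hx.le]
        have : x * L * L ≤ x * L * T := by gcongr; linarith
        linarith
    have := mul_le_mul_of_nonneg_left hmax (by positivity : 0 ≤ 18 * Real.exp 1 / 5)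
    linarith

end Params

/-! ### The potential of the restarted algorithm. -/

section

variable {N K : ℕ} [NeZero N]

/-- The regret of one round of follow-the-regularized-leader with importance-weighted estimates,
in terms of the decrease of the optimal value of the objective. -/
theorem ftrl_round {q η X : ℝ} (hq0 : 0 < q) (hq1 : q < 1) (hη : 0 < η)
    (hη' : η ≤ q / (1 - q) * (1 - Real.exp ((q - 1) / (2 - q)))) (hX : 0 < X)
    (θ : Advice N K) {ℓ : Fin K → ℝ} (hℓ : ∀ a, 0 ≤ ℓ a ∧ ℓ a ≤ 1) {Y : Fin N → ℝ}
    {p : stdSimplex ℝ (Fin N)} (hp : ∀ p', ftrlObjective q η Y p ≤ ftrlObjective q η Y p')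
    (i : Fin N) (p' : Fin K → stdSimplex ℝ (Fin N)) :
    ∑ a, mix θ p a * (ℓ a + ((Y i + lossEstimate θ p a (ℓ a) i) -
        ftrlObjective q η (fun j => Y j + lossEstimate θ p a (ℓ a) j) (p' a) / η)) ≤
      expertLoss θ ℓ i + (Y i - ftrlObjective q η Y p / η) +
        Real.exp 1 * η / (2 * q) * ((1 - q) * X ^ q + q * X ^ (q - 1) * Q θ p) := by
  have key : ∀ a, mix θ p a * (ℓ a + ((Y i + lossEstimate θ p a (ℓ a) i) -
        ftrlObjective q η (fun j => Y j + lossEstimate θ p a (ℓ a) j) (p' a) / η)) ≤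
      (θ i).1 a * ℓ a + mix θ p a * (Y i - ftrlObjective q η Y p / η) +
        Real.exp 1 * η / (2 * q) * ∑ j, p.1 j ^ (2 - q) *
          (mix θ p a * ((θ j).1 a / mix θ p a - 1) ^ 2) := by
    intro a
    have hθ := (θ i).2.1 a
    rcases (mix_nonneg θ p a).eq_or_lt with h0 | h0
    · rw [← h0]
      simp only [zero_mul, mul_zero, Finset.sum_const_zero, add_zero]
      exact mul_nonneg hθ (hℓ a).1
    set m := mix θ p a with hm
    -- Subtracting the observed loss shifts the objective by a constant, and makes the perturbation
    -- centred under `p` and at least `-1`, with squares that average to chi-squared divergences.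
    let z : Fin N → ℝ := fun j => lossEstimate θ p a (ℓ a) j - ℓ a
    have hz : ∀ j, z j = ((θ j).1 a / m - 1) * ℓ a := fun j => by
      simp only [z, lossEstimate, ← hm]
      ring
    have hz1 : ∀ j, -1 ≤ z j := fun j => by
      have h1 : 0 ≤ (θ j).1 a / m := div_nonneg ((θ j).2.1 a) h0.le
      rw [hz]
      nlinarith [(hℓ a).1, (hℓ a).2]
    have hpz : ∑ j, p.1 j * z j = 0 := by
      have : ∑ j, p.1 j * z j = (∑ j, p.1 j * (θ j).1 a) / m * ℓ a - (∑ j, p.1 j) * ℓ a := by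
        rw [Finset.sum_div, Finset.sum_mul, Finset.sum_mul, ← Finset.sum_sub_distrib]
        refine Finset.sum_congr rfl fun j _ => ?_
        rw [hz]
        ring
      rw [this, p.2.2, show ∑ j, p.1 j * (θ j).1 a = m from rfl, div_self h0.ne']
      ring
    have stab := ftrl_stability hq0 hq1 hη hη' hp z hz1 hpz (p' a)
    have hshift : ftrlObjective q η (fun j => Y j + lossEstimate θ p a (ℓ a) j) (p' a) =
        ftrlObjective q η (fun j => Y j + z j) (p' a) + η * ℓ a := by
      have : ∑ j, (Y j + lossEstimate θ p a (ℓ a) j) * (p' a).1 j =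
          ∑ j, (Y j + z j) * (p' a).1 j + ℓ a * ∑ j, (p' a).1 j := by
        rw [Finset.mul_sum, ← Finset.sum_add_distrib]
        refine Finset.sum_congr rfl fun j _ => ?_
        simp only [z]
        ring
      simp only [ftrlObjective]
      rw [this, (p' a).2.2]
      ring
    have hsq : ∑ j, p.1 j ^ (2 - q) * z j ^ 2 ≤
        ∑ j, p.1 j ^ (2 - q) * ((θ j).1 a / m - 1) ^ 2 := by
      refine Finset.sum_le_sum fun j _ => ?_
      have h1 : 0 ≤ p.1 j ^ (2 - q) := Real.rpow_nonneg (p.2.1 j) _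
      rw [hz, mul_pow]
      have h2 : ℓ a ^ 2 ≤ 1 := pow_le_one₀ (hℓ a).1 (hℓ a).2
      exact mul_le_mul_of_nonneg_left (mul_le_of_le_one_right (sq_nonneg _) h2) h1
    have hest : m * lossEstimate θ p a (ℓ a) i = (θ i).1 a * ℓ a := by
      simp only [lossEstimate, ← hm]
      field_simp
    rw [hshift]
    set V := ∑ j, p.1 j ^ (2 - q) * z j ^ 2
    set W := ∑ j, p.1 j ^ (2 - q) * ((θ j).1 a / m - 1) ^ 2 with hW
    set F := ftrlObjective q η Y p
    set F' := ftrlObjective q η (fun j => Y j + z j) (p' a)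
    have hdiv : F / η ≤ F' / η + Real.exp 1 * η / (2 * q) * V := by
      rw [div_le_iff₀ hη]
      refine stab.trans_eq ?_
      field_simp
    have hVW : Real.exp 1 * η / (2 * q) * V ≤ Real.exp 1 * η / (2 * q) * W := by gcongr
    have hmW : ∑ j, p.1 j ^ (2 - q) * (m * ((θ j).1 a / m - 1) ^ 2) = m * W := by
      rw [hW, Finset.mul_sum]
      exact Finset.sum_congr rfl fun j _ => by ring
    rw [hmW, ← hest]
    have e1 : (F' + η * ℓ a) / η = F' / η + ℓ a := by field_simp
    rw [e1]
    calc _ ≤ m * (lossEstimate θ p a (ℓ a) i + (Y i - F / η) +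
          Real.exp 1 * η / (2 * q) * W) := by
            refine mul_le_mul_of_nonneg_left ?_ h0.le
            linarith
      _ = _ := by ring
  refine (Finset.sum_le_sum fun a _ => key a).trans ?_
  rw [Finset.sum_add_distrib, Finset.sum_add_distrib, ← Finset.sum_mul, sum_mix, one_mul,
    ← Finset.mul_sum, Finset.sum_comm]
  simp only [← Finset.mul_sum]
  exact add_le_add le_rfl (mul_le_mul_of_nonneg_left (sum_rpow_mul_chiSq_le θ p hq0 hq1 hX)
    (by positivity))

/-- The potential that bounds the regret against expert `i` from round `t` on, if the exponent
never exceeds `R`. -/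
def potential (T : ℕ) (R : ℤ) (i : Fin N) (t : ℕ) (S : State N) : ℝ :=
  S.cumLoss i - ftrlObjective (qParam N S.r) (etaParam N T S.r) S.cumLoss S.p /
      etaParam N T S.r +
    Real.exp 1 * etaParam N T S.r / (2 * qParam N S.r) *
      (((T : ℝ) - t) * ((1 - qParam N S.r) * ((2 : ℝ) ^ (S.r + 1)) ^ qParam N S.r) +
        qParam N S.r * ((2 : ℝ) ^ (S.r + 1)) ^ (qParam N S.r - 1) *
          (T * 2 ^ (S.r + 1) - S.cumQ)) +
    ∑ k ∈ Finset.Ioc S.r R, (1 + epochCost N T k)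

/-- The invariants of the learner's state at the beginning of round `t`. -/
structure StateInv (T : ℕ) (θ : ℕ → Advice N K) (R : ℤ) (t : ℕ) (S : State N) : Prop where
  isMin : ∀ p', ftrlObjective (qParam N S.r) (etaParam N T S.r) S.cumLoss S.p ≤
    ftrlObjective (qParam N S.r) (etaParam N T S.r) S.cumLoss p'
  cumQ_le_capacity : S.cumQ ≤ ∑ s ∈ Finset.range t, capacity (θ s)
  cumQ_le : S.cumQ ≤ T * 2 ^ (S.r + 1)
  r_le : S.r ≤ R

theorem rpow_sub_one_mul {X q : ℝ} (hX : 0 < X) : X ^ (q - 1) * X = X ^ q := by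
  rw [Real.rpow_sub hX, Real.rpow_one]
  field_simp

/-- A tangent meets its curve at the point of contact: the two parts of a full variance budget add
up to at most `T X^q` with `X = 2^(r+1)`. -/
theorem potential_fresh_le {T : ℕ} {R r : ℤ} (hN : 1 < N) (hT : 0 < T) (hR : (2 : ℝ) ^ R < N)
    (hr : r ≤ R) (i : Fin N) (t : ℕ) :
    potential T R i t ⟨r, uniform N, 0, 0⟩ ≤
      epochCost N T r + ∑ k ∈ Finset.Ioc r R, (1 + epochCost N T k) := by
  have hr' := zpow_lt_of_le hR hr
  have h0 := half_lt_qParam hr'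
  have h1 := qParam_lt_one hr'
  have hη := etaParam_pos hN hT hr'
  simp only [potential, epochCost, entropyRange, ftrlObjective_zero, tsallis_uniform,
    Pi.zero_apply, sub_zero]
  set q := qParam N r
  set η := etaParam N T r
  set X : ℝ := 2 ^ (r + 1)
  have hX : 0 < X := by positivity
  have hXq := Real.rpow_pos_of_pos hX q
  have hq : 0 < q := by linarith
  have e1 : ((T : ℝ) - t) * ((1 - q) * X ^ q) + q * X ^ (q - 1) * (T * X) ≤ T * X ^ q := by
    have e2 : q * X ^ (q - 1) * (T * X) = q * T * X ^ q := by
      linear_combination q * T * rpow_sub_one_mul (q := q) hX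
    have e3 : 0 ≤ (t : ℝ) * ((1 - q) * X ^ q) :=
      mul_nonneg (Nat.cast_nonneg t) (mul_nonneg (by linarith) hXq.le)
    rw [e2]
    linarith
  have e4 : Real.exp 1 * η / (2 * q) * (((T : ℝ) - t) * ((1 - q) * X ^ q) +
      q * X ^ (q - 1) * (T * X)) ≤ Real.exp 1 * η / (2 * q) * (T * X ^ q) := by gcongr
  rw [neg_div]
  linarith

/-- What remains of the current epoch is nonnegative: the vertex at `i` has zero entropy, so the
minimum is at most `η * S.cumLoss i`, and the budget is not overdrawn. It lets an epoch be abandoned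
at a restart or at time `T`. -/
theorem le_potential {N K T : ℕ} {R : ℤ} {θ : ℕ → Advice N K} (hN : 1 < N) (hT : 0 < T)
    (hR : (2 : ℝ) ^ R < N) (i : Fin N) {t : ℕ} (ht : t ≤ T) {S : State N}
    (hS : StateInv T θ R t S) :
    ∑ k ∈ Finset.Ioc S.r R, (1 + epochCost N T k) ≤ potential T R i t S := by
  have hr' := zpow_lt_of_le hR hS.r_le
  have h0 := half_lt_qParam hr'
  have h1 := qParam_lt_one hr'
  have hη := etaParam_pos hN hT hr'
  have hmin := hS.isMin ⟨Pi.single i 1, single_mem_stdSimplex ℝ i⟩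
  have hQ := hS.cumQ_le
  rw [potential]
  set q := qParam N S.r
  set η := etaParam N T S.r
  set X : ℝ := 2 ^ (S.r + 1)
  have hX : 0 < X := by positivity
  have hq : 0 < q := by linarith
  have hvert : ftrlObjective q η S.cumLoss ⟨Pi.single i 1, single_mem_stdSimplex ℝ i⟩ =
      η * S.cumLoss i := by
    have h2 : ∀ j, (Pi.single i (1 : ℝ) : Fin N → ℝ) j ^ q = if j = i then 1 else 0 := by
      intro j
      rw [Pi.single_apply]
      split_ifs
      · exact Real.one_rpow q
      · exact Real.zero_rpow hq.ne'
    simp only [ftrlObjective, tsallis, h2]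
    simp [Pi.single_apply]
  rw [hvert] at hmin
  have e1 : ftrlObjective q η S.cumLoss S.p / η ≤ S.cumLoss i := by
    rw [div_le_iff₀ hη]
    linarith
  have e2 : 0 ≤ ((T : ℝ) - t) * ((1 - q) * X ^ q) + q * X ^ (q - 1) * (T * X - S.cumQ) := by
    have h3 : 0 ≤ (T : ℝ) - t := sub_nonneg.2 (by exact_mod_cast ht)
    have h4 : 0 ≤ 1 - q := by linarith
    have h5 : 0 ≤ T * X - S.cumQ := by linarith
    positivity
  have e3 : 0 ≤ Real.exp 1 * η / (2 * q) := by positivity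
  have := mul_nonneg e3 e2
  linarith

theorem expertLoss_nonneg {N K : ℕ} {θ : Advice N K} {ℓ : Fin K → ℝ} (hℓ : ∀ a, 0 ≤ ℓ a)
    (i : Fin N) : 0 ≤ expertLoss θ ℓ i :=
  Finset.sum_nonneg fun a _ => mul_nonneg ((θ i).2.1 a) (hℓ a)

/-- After a restart, the new exponent exceeds the old one. -/
theorem lt_restart_exponent {r : ℤ} {y : ℝ} (hy : (2 : ℝ) ^ (r + 1) < y) :
    r < ⌈Real.logb 2 y⌉ - 1 := by
  have h0 : (0 : ℝ) < 2 ^ (r + 1) := by positivity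
  have h1 : ((r + 1 : ℤ) : ℝ) < Real.logb 2 y := by
    rw [Real.lt_logb_iff_rpow_lt one_lt_two (h0.trans hy), Real.rpow_intCast]
    exact hy
  have := Int.lt_ceil.2 h1
  omega

/-- Strictness matters: it gives `2^r < N` even for `y = N`, which keeps `q_r` strictly between
`1/2` and `1`. -/
theorem zpow_ceil_logb_sub_one_lt {y : ℝ} (hy : 0 < y) : (2 : ℝ) ^ (⌈Real.logb 2 y⌉ - 1) < y := by
  rw [← Real.rpow_intCast, ← Real.lt_logb_iff_rpow_lt one_lt_two hy]
  push_cast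
  have := Int.ceil_lt_add_one (Real.logb 2 y)
  linarith

theorem cumQ_add_le {N K T t : ℕ} {θ : ℕ → Advice N K} {R : ℤ} {S : State N}
    (hS : StateInv T θ R t S) :
    S.cumQ + Q (θ t) S.p ≤ ∑ s ∈ Finset.range (t + 1), capacity (θ s) := by
  rw [Finset.sum_range_succ]
  exact add_le_add hS.cumQ_le_capacity (Q_le_capacity _ _)

theorem inv_mul_cumQ_le_avgCapacity {T t : ℕ} (ht : t < T) {θ : ℕ → Advice N K} {R : ℤ}
    {S : State N} (hS : StateInv T θ R t S) :
    1 / (T : ℝ) * (S.cumQ + Q (θ t) S.p) ≤ avgCapacity T θ := by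
  refine mul_le_mul_of_nonneg_left ((cumQ_add_le hS).trans ?_) (by positivity)
  exact Finset.sum_le_sum_of_subset_of_nonneg (Finset.range_mono ht)
    fun s _ _ => capacity_nonneg (θ s)

theorem restart_exponent_le {y M : ℝ} (hy : 0 < y) (hyM : y ≤ M) :
    ⌈Real.logb 2 y⌉ - 1 ≤ ⌈Real.logb 2 M⌉ - 1 :=
  sub_le_sub_right (Int.ceil_mono (Real.logb_le_logb_of_le one_lt_two hy hyM)) 1

theorem uniform_isMin {r : ℤ} {T : ℕ} (hr : (2 : ℝ) ^ r < N) (p' : stdSimplex ℝ (Fin N)) :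
    ftrlObjective (qParam N r) (etaParam N T r) 0 (uniform N) ≤
      ftrlObjective (qParam N r) (etaParam N T r) 0 p' := by
  rw [ftrlObjective_zero, ftrlObjective_zero]
  have := half_lt_qParam hr
  exact tsallis_uniform_le (by linarith) (qParam_lt_one hr) p'

theorem stateInv_fresh {T t : ℕ} {θ : ℕ → Advice N K} {R r : ℤ} (hR : (2 : ℝ) ^ R < N)
    (hr : r ≤ R) : StateInv T θ R t ⟨r, uniform N, 0, 0⟩ where
  isMin := uniform_isMin (zpow_lt_of_le hR hr)
  cumQ_le_capacity := Finset.sum_nonneg fun s _ => capacity_nonneg (θ s)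
  cumQ_le := by positivity
  r_le := hr

/-- The regret of the algorithm is bounded by the costs of the epochs with exponents up to the
largest possible one, and one for each restart. -/
theorem regret_le_sum_epochCost {T : ℕ} (hN : 1 < N) (hT : 0 < T) {θ : ℕ → Advice N K}
    {ℓ : ℕ → Fin K → ℝ} (hℓ : ∀ t < T, ∀ a, 0 ≤ ℓ t a ∧ ℓ t a ≤ 1) {J : ℝ} (hJ : 0 < J)
    (hJN : J ≤ N) :
    regret T J θ ℓ ≤ epochCost N T (⌈Real.logb 2 J⌉ - 1) +
      ∑ k ∈ Finset.Ioc (⌈Real.logb 2 J⌉ - 1) (⌈Real.logb 2 (max (avgCapacity T θ) J)⌉ - 1),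
        (1 + epochCost N T k) := by
  set M := max (avgCapacity T θ) J
  have hM : 0 < M := lt_max_of_lt_right hJ
  have hMN : M ≤ N := max_le (avgCapacity_le hT θ) hJN
  set R := ⌈Real.logb 2 M⌉ - 1
  have hR : (2 : ℝ) ^ R < N := (zpow_ceil_logb_sub_one_lt hM).trans_le hMN
  have hr1 : ⌈Real.logb 2 J⌉ - 1 ≤ R := restart_exponent_le hJ (le_max_right _ _)
  have hT' : (0 : ℝ) < T := by exact_mod_cast hT
  refine regret_le_of_forall fun i => ?_
  refine (sum_loss_le_of_potential T J θ ℓ i (StateInv T θ R) (potential T R i)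
    (stateInv_fresh hR hr1) ?_ ?_ ?_).trans
    (add_le_add le_rfl (potential_fresh_le hN hT hR hr1 i 0))
  · intro t ht S hS a
    rw [step]
    have hy := inv_mul_cumQ_le_avgCapacity ht hS
    split_ifs with h
    · have hy0 : 0 < 1 / (T : ℝ) * (S.cumQ + Q (θ t) S.p) := lt_trans (by positivity) h
      exact stateInv_fresh hR (restart_exponent_le hy0 (hy.trans (le_max_left _ _)))
    · have hq := half_lt_qParam (zpow_lt_of_le hR hS.r_le)
      refine ⟨ftrl_spec (by linarith) _ _, cumQ_add_le hS, ?_, hS.r_le⟩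
      have h' := not_lt.1 h
      rw [one_div_mul_eq_div, div_le_iff₀ hT'] at h'
      simpa [mul_comm] using h'
  · intro t ht S hS
    have hy := inv_mul_cumQ_le_avgCapacity ht hS
    by_cases h : 1 / (T : ℝ) * (S.cumQ + Q (θ t) S.p) > 2 ^ (S.r + 1)
    · have hy0 : 0 < 1 / (T : ℝ) * (S.cumQ + Q (θ t) S.p) := lt_trans (by positivity) h
      simp only [step, if_pos h]
      set r' := ⌈Real.logb 2 (1 / (T : ℝ) * (S.cumQ + Q (θ t) S.p))⌉ - 1
      have hr'R : r' ≤ R := restart_exponent_le hy0 (hy.trans (le_max_left _ _))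
      have hr' : S.r < r' := lt_restart_exponent h
      have h1 := potential_fresh_le hN hT hR hr'R i (t + 1)
      have h2 := le_potential hN hT hR i ht.le hS
      -- The term of `r'` pays for the new epoch and, through its `1`, for the loss in the round
      -- that triggers the restart; skipped exponents only leave slack.
      have h3 : (1 + epochCost N T r') + ∑ k ∈ Finset.Ioc r' R, (1 + epochCost N T k) ≤
          ∑ k ∈ Finset.Ioc S.r R, (1 + epochCost N T k) := by
        rw [← Finset.sum_insert (f := fun k => 1 + epochCost N T k)
          (by simp : r' ∉ Finset.Ioc r' R)]
        refine Finset.sum_le_sum_of_subset_of_nonneg ?_ fun k hk _ => ?_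
        · intro k hk
          simp only [Finset.mem_insert, Finset.mem_Ioc] at hk ⊢
          omega
        · have := epochCost_nonneg hN hT (zpow_lt_of_le hR (Finset.mem_Ioc.1 hk).2)
          linarith
      simp only [mul_add, Finset.sum_add_distrib, ← Finset.sum_mul, sum_mix, one_mul]
      have h4 : ∑ a, mix (θ t) S.p a * ℓ t a ≤ 1 := by
        rw [← sum_mix (θ t) S.p]
        exact Finset.sum_le_sum fun a _ =>
          mul_le_of_le_one_right (mix_nonneg _ _ a) (hℓ t ht a).2
      have h5 := expertLoss_nonneg (θ := θ t) (fun a => (hℓ t ht a).1) i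
      linarith
    · simp only [step, if_neg h]
      have hr := zpow_lt_of_le hR hS.r_le
      have hq := half_lt_qParam hr
      have hround := ftrl_round (X := 2 ^ (S.r + 1)) (by linarith) (qParam_lt_one hr)
        (etaParam_pos hN hT hr) (min_le_right _ _) (by positivity) (θ t) (hℓ t ht) hS.isMin i
        fun a => ftrl (qParam N S.r) (etaParam N T S.r)
          fun j => S.cumLoss j + lossEstimate (θ t) S.p a (ℓ t a) j
      simp only [potential, ← add_assoc (ℓ t _), mul_add (mix (θ t) S.p _),
        Finset.sum_add_distrib, ← Finset.sum_mul, sum_mix, one_mul] at hround ⊢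
      push_cast
      linarith
  · intro S hS
    refine le_trans (Finset.sum_nonneg fun k hk => ?_) (le_potential hN hT hR i le_rfl hS)
    have := epochCost_nonneg hN hT (zpow_lt_of_le hR (Finset.mem_Ioc.1 hk).2)
    linarith

/-- A single expert has no regret. -/
theorem regret_le_zero_of_subsingleton [Subsingleton (Fin N)] (T : ℕ) (J : ℝ)
    (θ : ℕ → Advice N K) (ℓ : ℕ → Fin K → ℝ) : regret T J θ ℓ ≤ 0 := by
  refine regret_le_of_forall fun i => ?_
  refine sum_loss_le_of_potential T J θ ℓ i (fun _ _ => True) (fun _ _ => 0) trivial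
    (fun _ _ _ _ _ => trivial) (fun t _ S _ => ?_) fun _ _ => le_rfl
  simp only [add_zero]
  rw [← sum_mul_sum_eq_sum_mix]
  have h : ∀ j, ∑ a, (θ t j).1 a * ℓ t a = expertLoss (θ t) (ℓ t) i := fun j => by
    rw [Subsingleton.elim j i, expertLoss]
  simp only [h]
  rw [← Finset.sum_mul, S.p.2.2, one_mul]

end

/-! ### Summation over exponents and the final bounds. -/

theorem sum_Icc_le_of_geometric {g : ℤ → ℝ} {ρ : ℝ} {r R : ℤ} (hρ : ρ < 1) (hg : ∀ k, 0 ≤ g k)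
    (h : ∀ k < R, g k ≤ ρ * g (k + 1)) (hrR : r ≤ R) :
    ∑ k ∈ Finset.Icc r R, g k ≤ g R / (1 - ρ) := by
  have h1 : 0 < 1 - ρ := by linarith
  suffices H : ∀ n, r ≤ n → n ≤ R → ∑ k ∈ Finset.Icc r n, g k ≤ g n / (1 - ρ) from
    H R hrR le_rfl
  intro n hn
  induction n, hn using Int.leInduction with
  | base =>
    intro _
    rw [Finset.Icc_self, Finset.sum_singleton, le_div_iff₀ h1]
    -- No sign of `ρ` is assumed; the growth condition one index below `r` supplies it.
    have hle : 0 ≤ ρ * g r := by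
      by_contra! hneg
      have h2 := h (r - 1)
      rw [sub_add_cancel] at h2
      linarith [h2 (by omega), hg (r - 1)]
    linarith
  | succ n hn ih =>
    intro hnR
    have hset : Finset.Icc r (n + 1) = insert (n + 1) (Finset.Icc r n) := by
      ext k
      simp only [Finset.mem_insert, Finset.mem_Icc]
      omega
    rw [hset, Finset.sum_insert (by simp)]
    have h2 := h n (by omega)
    have h3 : g n / (1 - ρ) ≤ ρ * g (n + 1) / (1 - ρ) := by gcongr
    have h4 : g (n + 1) / (1 - ρ) = g (n + 1) + ρ * g (n + 1) / (1 - ρ) := by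
      field_simp
      ring
    linarith [ih (by omega)]

/-- The number of integers `k ≥ ⌈log₂ J⌉ - 1` with `2 ^ k` below two thresholds. -/
theorem card_exponents_le {J M Λ T : ℝ} (hJ : 0 < J) (hM : 0 < M) (hΛ : 0 < Λ) (hT : 0 < T) :
    ((Finset.Icc (⌈Real.logb 2 J⌉ - 1) (⌈Real.logb 2 M⌉ - 1)).filter
      fun k : ℤ => (2 : ℝ) ^ k * T < Λ).card ≤ logTwoPos (4 * min (M * T) Λ / (J * T)) := by
  set s := (Finset.Icc (⌈Real.logb 2 J⌉ - 1) (⌈Real.logb 2 M⌉ - 1)).filter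
      fun k : ℤ => (2 : ℝ) ^ k * T < Λ with hs
  set m := min (M * T) Λ / T with hm
  have hm0 : 0 < m := by positivity
  have hsub : s ⊆ Finset.Icc (⌈Real.logb 2 J⌉ - 1) (⌈Real.logb 2 m⌉ - 1) := by
    intro k hk
    rw [hs, Finset.mem_filter, Finset.mem_Icc] at hk
    obtain ⟨⟨h1, h2⟩, h3⟩ := hk
    refine Finset.mem_Icc.2 ⟨h1, ?_⟩
    have h4 : (2 : ℝ) ^ k < M :=
      (zpow_le_zpow_right₀ one_le_two h2).trans_lt (zpow_ceil_logb_sub_one_lt hM)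
    have h5 : (2 : ℝ) ^ k < m := by
      rw [hm, lt_div_iff₀ hT]
      exact lt_min (by gcongr) h3
    have h6 : (k : ℝ) < Real.logb 2 m := by
      rw [Real.lt_logb_iff_rpow_lt one_lt_two hm0, Real.rpow_intCast]
      exact h5
    have := Int.lt_ceil.2 h6
    omega
  have hcard := Finset.card_le_card hsub
  rw [Int.card_Icc] at hcard
  rcases Nat.eq_zero_or_pos s.card with h0 | h0
  · rw [h0, Nat.cast_zero]
    exact le_max_right _ _
  · refine le_max_of_le_left ?_
    -- One unit for the closed interval and one for rounding up `log₂ m`: together they are the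
    -- factor `4 = 2²` in the logarithm.
    have h1 : (s.card : ℤ) ≤ ⌈Real.logb 2 m⌉ - ⌈Real.logb 2 J⌉ + 1 := by omega
    have h2 : (s.card : ℝ) ≤ (⌈Real.logb 2 m⌉ : ℝ) - ⌈Real.logb 2 J⌉ + 1 := by exact_mod_cast h1
    have h3 := Int.ceil_lt_add_one (Real.logb 2 m)
    have h4 := Int.le_ceil (Real.logb 2 J)
    have h5 : 4 * min (M * T) Λ / (J * T) = 4 * m / J := by
      rw [hm]
      field_simp
    have h6 : Real.logb 2 4 = 2 := by
      rw [show (4 : ℝ) = 2 ^ (2 : ℝ) by norm_num, Real.logb_rpow two_pos (by norm_num)]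
    rw [h5, Real.logb_div (by positivity) hJ.ne', Real.logb_mul (by norm_num) hm0.ne', h6]
    linarith

/-- The number of restarts. -/
theorem card_restarts_le {J C : ℝ} (hJ : 0 < J) :
    ((Finset.Ioc (⌈Real.logb 2 J⌉ - 1) (⌈Real.logb 2 (max C J)⌉ - 1)).card : ℝ) ≤
      logTwoPos (C / J) + 1 := by
  rw [Int.card_Ioc]
  rcases le_total C J with h | h
  · rw [max_eq_right h]
    have : 0 ≤ logTwoPos (C / J) := le_max_right _ _
    simp
    linarith
  · rw [max_eq_left h]
    have hC : 0 < C := hJ.trans_le h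
    have h1 := Int.ceil_mono (Real.logb_le_logb_of_le one_lt_two hJ h)
    have h2 : (((⌈Real.logb 2 C⌉ - 1 - (⌈Real.logb 2 J⌉ - 1)).toNat : ℤ) : ℝ) =
        (⌈Real.logb 2 C⌉ : ℝ) - ⌈Real.logb 2 J⌉ := by
      rw [Int.toNat_of_nonneg (by omega)]
      push_cast
      ring
    rw [Int.cast_natCast] at h2
    rw [h2]
    have h3 := Int.ceil_lt_add_one (Real.logb 2 C)
    have h4 := Int.le_ceil (Real.logb 2 J)
    have h5 : Real.logb 2 (C / J) ≤ logTwoPos (C / J) := le_max_left _ _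
    rw [Real.logb_div hC.ne' hJ.ne'] at h5
    linarith

theorem sum_sqrt_mul_logFactor_le {N T : ℕ} (hN : 0 < N) {J M : ℝ} (hJ : 0 < J) (hJM : J ≤ M)
    (hMN : M ≤ N) :
    ∑ k ∈ Finset.Icc (⌈Real.logb 2 J⌉ - 1) (⌈Real.logb 2 M⌉ - 1),
        Real.sqrt (T * ((2 : ℝ) ^ k * logFactor N (2 ^ k))) ≤
      Real.sqrt (M * T * logFactor N M) / (1 - 0.821) := by
  have hM := hJ.trans_le hJM
  set R := ⌈Real.logb 2 M⌉ - 1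
  have hR : (2 : ℝ) ^ R < M := zpow_ceil_logb_sub_one_lt hM
  refine (sum_Icc_le_of_geometric (g := fun k : ℤ =>
    Real.sqrt (T * ((2 : ℝ) ^ k * logFactor N (2 ^ k)))) (ρ := 0.821) (by norm_num)
    (fun k => Real.sqrt_nonneg _) ?_ (restart_exponent_le hJ hJM)).trans ?_
  · intro k hk
    have h1 : (2 : ℝ) ^ (k + 1) ≤ N :=
      ((zpow_le_zpow_right₀ one_le_two (by omega)).trans hR.le).trans hMN
    have h2 := half_mul_logFactor_le hN (by positivity : (0 : ℝ) < 2 ^ (k + 1)) h1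
    have h3 : (2 : ℝ) ^ (k + 1) / 2 = 2 ^ k := by rw [zpow_add_one₀ two_ne_zero]; simp
    rw [h3] at h2
    refine Real.sqrt_le_iff.2 ⟨by positivity, ?_⟩
    have h4 := two_le_logFactor hN h1
    rw [mul_pow, Real.sq_sqrt (mul_nonneg (Nat.cast_nonneg T)
      (mul_nonneg (by positivity) (by linarith)))]
    calc _ ≤ T * (0.821 ^ 2 * ((2 : ℝ) ^ (k + 1) * logFactor N (2 ^ (k + 1)))) := by gcongr
      _ = _ := by ring
  · refine div_le_div_of_nonneg_right (Real.sqrt_le_sqrt ?_) (by norm_num)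
    have := mul_logFactor_mono hN (by positivity) hR.le hMN
    calc _ ≤ T * (M * logFactor N M) := by gcongr
      _ = _ := by ring

theorem logTwoPos_nonneg (x : ℝ) : 0 ≤ logTwoPos x := le_max_right _ _

variable {N K : ℕ} [NeZero N]

/-- Regret bound for an arbitrary input `J`. -/
theorem regret_le {T : ℕ} {θ : ℕ → Advice N K} {ℓ : ℕ → Fin K → ℝ}
    (hℓ : ∀ t < T, ∀ a, 0 ≤ ℓ t a ∧ ℓ t a ≤ 1)
    (hT : Real.log (Real.exp 1 ^ 2 * N) ≤ T) {J : ℝ} (hJ : 0 < J) (hJN : J ≤ N) :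
    regret T J θ ℓ ≤
      38 * Real.exp 1 * Real.sqrt (max (avgCapacity T θ) J * T *
          logFactor N (max (avgCapacity T θ) J))
        + logTwoPos (avgCapacity T θ / J)
        + 18 * Real.exp 1 / 5 *
            logTwoPos (4 * min (max (avgCapacity T θ) J * T)
              (Real.log (Real.exp 1 ^ 2 * N)) / (J * T)) *
            Real.log (Real.exp 1 ^ 2 * N)
        + 1 := by
  have hN0 : 0 < N := Nat.pos_of_ne_zero (NeZero.ne N)
  have hΛ : 2 ≤ Real.log (Real.exp 1 ^ 2 * N) := by
    rw [← logFactor_of_le_one zero_le_one]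
    exact two_le_logFactor hN0 (Nat.cast_nonneg N)
  have hT' : (0 : ℝ) < T := by linarith
  have hT0 : 0 < T := by exact_mod_cast hT'
  rcases Nat.lt_or_ge 1 N with hN | hN
  swap
  -- For `N = 1` the entropy range vanishes, so the learning rate need not be positive and the epoch
  -- analysis does not apply.
  · have : Subsingleton (Fin N) := Fin.subsingleton_iff_le_one.2 hN
    refine (regret_le_zero_of_subsingleton T J θ ℓ).trans ?_
    have h1 := logTwoPos_nonneg (avgCapacity T θ / J)
    have h2 := logTwoPos_nonneg (4 * min (max (avgCapacity T θ) J * T)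
      (Real.log (Real.exp 1 ^ 2 * N)) / (J * T))
    positivity
  refine (regret_le_sum_epochCost hN hT0 hℓ hJ hJN).trans ?_
  set C := avgCapacity T θ
  set M := max C J
  have hJM : J ≤ M := le_max_right _ _
  have hM : 0 < M := hJ.trans_le hJM
  have hMN : M ≤ N := max_le (avgCapacity_le hT0 θ) hJN
  have hcard := card_restarts_le (C := C) hJ
  have hcount := card_exponents_le hJ hM (by linarith : 0 < Real.log (Real.exp 1 ^ 2 * N)) hT'
  have hgeom := sum_sqrt_mul_logFactor_le (T := T) hN0 hJ hJM hMN
  have hrR : ⌈Real.logb 2 J⌉ - 1 ≤ ⌈Real.logb 2 M⌉ - 1 := restart_exponent_le hJ hJM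
  set r := ⌈Real.logb 2 J⌉ - 1
  set R := ⌈Real.logb 2 M⌉ - 1
  have hR : (2 : ℝ) ^ R < N := (zpow_ceil_logb_sub_one_lt hM).trans_le hMN
  have hset : Finset.Icc r R = insert r (Finset.Ioc r R) := by
    ext k
    simp only [Finset.mem_insert, Finset.mem_Icc, Finset.mem_Ioc]
    omega
  have hsum : epochCost N T r + ∑ k ∈ Finset.Ioc r R, (1 + epochCost N T k) =
      ∑ k ∈ Finset.Icc r R, epochCost N T k + (Finset.Ioc r R).card := by
    rw [hset, Finset.sum_insert (by simp), Finset.sum_add_distrib, Finset.sum_const, nsmul_one]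
    ring
  set Λ := Real.log (Real.exp 1 ^ 2 * N)
  set s := Real.sqrt (M * T * logFactor N M)
  have he := Real.exp_pos 1
  have hepochs : ∑ k ∈ Finset.Icc r R, epochCost N T k ≤
      6.43 * Real.exp 1 * (s / (1 - 0.821)) +
        18 * Real.exp 1 / 5 * logTwoPos (4 * min (M * T) Λ / (J * T)) * Λ := by
    refine (Finset.sum_le_sum fun k hk =>
      epochCost_le hN hT (zpow_lt_of_le hR (Finset.mem_Icc.1 hk).2)).trans ?_
    rw [Finset.sum_add_distrib, ← Finset.mul_sum]
    refine add_le_add (mul_le_mul_of_nonneg_left hgeom (by positivity)) ?_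
    rw [← Finset.sum_filter, Finset.sum_const, nsmul_eq_mul]
    calc _ ≤ logTwoPos (4 * min (M * T) Λ / (J * T)) * (18 * Real.exp 1 / 5 * Λ) := by gcongr
      _ = _ := by ring
  have hconst : 6.43 * Real.exp 1 * (s / (1 - 0.821)) ≤ 38 * Real.exp 1 * s := by
    have h1 : 0 ≤ Real.exp 1 * s := by positivity
    have h2 : 6.43 * Real.exp 1 * (s / (1 - 0.821)) = 6430 / 179 * (Real.exp 1 * s) := by
      norm_num
      ring
    rw [h2]
    linarith
  rw [hsum]
  linarith

/-- Regret bound for the input `J = ln (e² N) / T`. -/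
theorem regret_le_of_default_input {T : ℕ} {θ : ℕ → Advice N K} {ℓ : ℕ → Fin K → ℝ}
    (hℓ : ∀ t < T, ∀ a, 0 ≤ ℓ t a ∧ ℓ t a ≤ 1)
    (hT : Real.log (Real.exp 1 ^ 2 * N) ≤ T) :
    regret T (Real.log (Real.exp 1 ^ 2 * N) / T) θ ℓ ≤
      38 * Real.exp 1 * Real.sqrt (avgCapacity T θ * T * logFactor N (avgCapacity T θ))
        + logTwoPos (avgCapacity T θ * T / Real.log (Real.exp 1 ^ 2 * N))
        + 46 * Real.exp 1 * Real.log (Real.exp 1 ^ 2 * N)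
        + 1 := by
  have hN0 : 0 < N := Nat.pos_of_ne_zero (NeZero.ne N)
  have hΛ : 2 ≤ Real.log (Real.exp 1 ^ 2 * N) := by
    rw [← logFactor_of_le_one zero_le_one]
    exact two_le_logFactor hN0 (Nat.cast_nonneg N)
  have hT' : (0 : ℝ) < T := by linarith
  set Λ := Real.log (Real.exp 1 ^ 2 * N) with hΛdef
  have hJ : 0 < Λ / T := div_pos (by linarith) hT'
  have hJ1 : Λ / T ≤ 1 := (div_le_one hT').2 hT
  have hN1 : (1 : ℝ) ≤ N := by exact_mod_cast hN0
  have hJT : Λ / T * T = Λ := div_mul_cancel₀ _ hT'.ne'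
  refine (regret_le hℓ hT hJ (hJ1.trans hN1)).trans ?_
  set C := avgCapacity T θ
  have hmin : min (max C (Λ / T) * T) Λ = Λ := by
    refine min_eq_right ?_
    calc Λ = Λ / T * T := hJT.symm
      _ ≤ _ := by gcongr; exact le_max_right _ _
  have hlog : logTwoPos (4 * Λ / Λ) = 2 := by
    rw [mul_div_cancel_right₀ _ (by linarith : Λ ≠ 0), logTwoPos,
      show (4 : ℝ) = 2 ^ (2 : ℝ) by norm_num, Real.logb_rpow two_pos (by norm_num)]
    norm_num
  have hC : C / (Λ / T) = C * T / Λ := by field_simp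
  -- If `J = Λ / T` dominates, then `J ≤ 1` makes the logarithmic factor `Λ`, and the root equals
  -- `√(Λ²) = Λ`. The final constant is `38 + 2 * 18/5 ≤ 46`.
  have hsqrt : Real.sqrt (max C (Λ / T) * T * logFactor N (max C (Λ / T))) ≤
      Real.sqrt (C * T * logFactor N C) + Λ := by
    rcases le_total C (Λ / T) with h | h
    · rw [max_eq_right h, hJT, logFactor_of_le_one hJ1, ← hΛdef, Real.sqrt_mul_self (by linarith)]
      linarith [Real.sqrt_nonneg (C * T * logFactor N C)]
    · rw [max_eq_left h]
      linarith
  rw [← hΛdef, hmin, hJT, hlog, hC]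
  have he := Real.exp_pos 1
  have h1 := mul_le_mul_of_nonneg_left hsqrt (by positivity : 0 ≤ 38 * Real.exp 1)
  have h2 : 0 ≤ Real.exp 1 * Λ := by positivity
  linarith

end ExpertAdvice
end

open ExpertAdvice in
theorem theorem2 (N K T : ℕ) [NeZero N]
    (θ : ℕ → Fin N → stdSimplex ℝ (Fin K)) (ℓ : ℕ → Fin K → ℝ)
    (hℓ : ∀ t < T, ∀ a, 0 ≤ ℓ t a ∧ ℓ t a ≤ 1)
    (hT : Real.log (Real.exp 1 ^ 2 * N) ≤ T) :
    (∀ J : ℝ, 0 < J → J ≤ N →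
      regret T J θ ℓ ≤
        38 * Real.exp 1 * Real.sqrt (max (avgCapacity T θ) J * T *
            Real.log (Real.exp 1 ^ 2 * N / max (max (avgCapacity T θ) J) 1))
          + logTwoPos (avgCapacity T θ / J)
          + 18 * Real.exp 1 / 5 *
              logTwoPos (4 * min (max (J * T) (avgCapacity T θ * T))
                (Real.log (Real.exp 1 ^ 2 * N)) / (J * T)) *
              Real.log (Real.exp 1 ^ 2 * N)
          + 1) ∧
    regret T (Real.log (Real.exp 1 ^ 2 * N) / T) θ ℓ ≤
      38 * Real.exp 1 * Real.sqrt (avgCapacity T θ * T *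
          Real.log (Real.exp 1 ^ 2 * N / max (avgCapacity T θ) 1))
        + logTwoPos (avgCapacity T θ * T / Real.log (Real.exp 1 ^ 2 * N))
        + 46 * Real.exp 1 * Real.log (Real.exp 1 ^ 2 * N)
        + 1 := by
  refine ⟨fun J hJ hJN => ?_, regret_le_of_default_input hℓ hT⟩
  rw [max_comm (J * T), ← max_mul_of_nonneg _ _ (Nat.cast_nonneg (α := ℝ) T)]
  exact regret_le hℓ hT hJ hJN
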